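/- **Setting.** Let $(W,S)$ be a Coxeter system with length function $\ell$, Bruhat order $\le$ and left weak order $\le_L$ ($x\le_L y$ iff $y=zx$ with $\ell(y)=\ell(z)+\ell(x)$), and put $\epsilon_w=(-1)^{\ell(w)}$. Let $\Gamma$ be a totally ordered abelian group and $L:S\to\Gamma$ with $L(s)\ge 0$ and $L(s)=L(t)$ whenever $s,t$ are conjugate in $W$. Let $R\subseteq\mathbb C$ be a subring, $A=R[\Gamma]$ with $R$-basis $\{q^\gamma\}_{\gamma\in\Gamma}$, let $A_{\ge0}$ (resp. $A_{>0}$) be the span of the $q^\gamma$ with $\gamma\ge0$ (resp. $\gamma>0$), and let $\bar{\ }$ be the ring automorphism of $A$ that fixes $R$ and sends $q^\gamma$ to $q^{-\gamma}$. Let $\mathcal H$ be the generic Hecke algebra over $A$, with generators $T_s$ $(s\in S)$, the braid relations and $T_s^2=1+(q^{L(s)}-q^{-L(s)})T_s$. Let $h\mapsto\bar h$ be the semilinear ring involution of $\mathcal H$ with $\overline{T_s}=T_s^{-1}$, and $\Phi:\mathcal H\to\mathcal H$ the $A$-algebra map with $\Phi(T_s)=-\overline{T_s}$ (so $\Phi(T_w)=\epsilon_w\overline{T_w}$).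 Let $\mathbf E_J\subseteq W$ be a nonempty ideal of $(W,\le_L)$ and $J\subseteq S$ with $\mathbf E_J\subseteq D_J=\{w:\ell(ws)>\ell(w)\ \forall s\in J\}$. Assume that $\mathbf E_J$ is a $W$-graph ideal with respect to $J$ and $L$, with module $M=M(\mathbf E_J,L)$; that is, $M$ is an $\mathcal H$-module with an $A$-basis $\{\Gamma_w\mid w\in\mathbf E_J\}$ such that, for all $s\in S$, $w\in\mathbf E_J$, $$T_s\Gamma_w=\begin{cases}\Gamma_{sw}+(q^{L(s)}-q^{-L(s)})\Gamma_w&\text{if }\ell(sw)<\ell(w),\ sw\in\mathbf E_J,\\ \Gamma_{sw}&\text{if }\ell(sw)>\ell(w),\ sw\in\mathbf E_J,\\ -q^{-L(s)}\Gamma_w&\text{if }\ell(sw)>\ell(w),\ sw\notin D_J,\\ q^{L(s)}\Gamma_w-\sum_{z\in\mathbf E_J,\,z<w}r^s_{z,w}\Gamma_z&\text{if }\ell(sw)>\ell(w),\ sw\in D_J\setminus\mathbf E_J,\end{cases}$$ with $r^s_{z,w}\in q^{L(s)}A_{>0}$, and $M$ has an $A$-semilinear involution $\bar{\ }$ with $\overline{\Gamma_1}=\Gamma_1$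 and $\overline{h\alpha}=\bar h\,\bar\alpha$. A dual module $\widetilde M$ is an $\mathcal H$-module with an $A$-basis $\{\widetilde\Gamma_w\mid w\in\mathbf E_J\}$ on which $T_s$ acts by the same formulas in the first two cases, by $T_s\widetilde\Gamma_w=q^{L(s)}\widetilde\Gamma_w$ in the third, and by $T_s\widetilde\Gamma_w=-q^{-L(s)}\widetilde\Gamma_w+\sum_{z\in\mathbf E_J,\,z<w}\epsilon_z\epsilon_w\overline{r^s_{z,w}}\,\widetilde\Gamma_z$ in the fourth, with an $A$-semilinear involution such that $\overline{\widetilde\Gamma_1}=\widetilde\Gamma_1$ and $\overline{h\alpha}=\bar h\,\bar\alpha$. Define $R_{y,x},\widetilde R_{y,x}\in A$ by $\overline{\Gamma_x}=\sum_y R_{y,x}\Gamma_y$ and $\overline{\widetilde\Gamma_x}=\sum_y\widetilde R_{y,x}\widetilde\Gamma_y$. **Proposition 3.6.** A dual module $\widetilde M$ exists. For every dual module $\widetilde M$ there are unique $\Phi$-linear maps $\eta:M\to\widetilde M$ with $\eta(\Gamma_1)=\widetilde\Gamma_1$ and $\theta:\widetilde M\to M$ with $\theta(\widetilde\Gamma_1)=\Gamma_1$,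 and these are inverse to each other. There are unique families of bar-invariant elements $\mathbf C_w=\sum_{y}P_{y,w}\Gamma_y\in M$ and $\widetilde{\mathbf C}_w=\sum_{y}\widetilde P_{y,w}\widetilde\Gamma_y\in\widetilde M$ ($w\in\mathbf E_J$) with coefficients in $A_{\ge0}$ such that the $(y,w)$-coefficient is $0$ if $y\not\le w$, is $1$ if $y=w$, and has zero constant term if $y\ne w$. Put $\mathbf C'_w=\theta(\widetilde{\mathbf C}_w)$ and $\widetilde{\mathbf C}'_w=\eta(\mathbf C_w)$. Then: (a) $\{\mathbf C'_w\mid w\in\mathbf E_J\}$ is an $A$-basis of $M$, $\overline{\mathbf C'_w}=\mathbf C'_w$, and $$\mathbf C'_w=\sum_{y\in\mathbf E_J}\epsilon_y\,\overline{\widetilde P_{y,w}}\,\Gamma_y ,$$ where $\widetilde P_{y,w}\in A_{\ge0}$ satisfy: (a1) $\widetilde P_{y,w}=0$ if $y\not\le w$; (a2) $\widetilde P_{w,w}=1$; (a3) $\widetilde P_{y,w}$ has zero constant term if $y\neq w$, and $$\overline{\widetilde P_{y,w}}-\widetilde P_{y,w}=\sum_{x\in\mathbf E_J,\ y<x\le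 w}\overline{\widetilde R_{y,x}}\,\widetilde P_{x,w}\qquad\text{for all }y<w .$$ It is the unique such family: if $c_w=\sum_y\epsilon_y\overline{p_{y,w}}\,\Gamma_y$ are bar-invariant with $p_{y,w}\in A_{\ge0}$, $p_{y,w}=0$ for $y\not\le w$, $p_{w,w}=1$, and zero constant term of $p_{y,w}$ for $y\ne w$, then $c_w=\mathbf C'_w$ and $p_{y,w}=\widetilde P_{y,w}$. (b) Analogously, $\{\widetilde{\mathbf C}'_w\mid w\in\mathbf E_J\}$ is an $A$-basis of $\widetilde M$, $\overline{\widetilde{\mathbf C}'_w}=\widetilde{\mathbf C}'_w$, and $$\widetilde{\mathbf C}'_w=\sum_{y\in\mathbf E_J}\epsilon_y\,\overline{P_{y,w}}\,\widetilde\Gamma_y ,$$ where the $P_{y,w}$ have the properties of (a) with $R$ in place of $\widetilde R$; it is the unique such family in $\widetilde M$. -/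

import Mathlib

noncomputable section

namespace WGraph

/-! ### The coefficient ring -/

/-- The ring `A = R[Γ]`, free over `R` with basis the powers `q ^ γ`, `γ ∈ Γ`. -/
abbrev Coeff (R : Subring ℂ) (Γ : Type*) [AddCommGroup Γ] : Type _ := AddMonoidAlgebra R Γ

section Coeff

variable {R : Subring ℂ} {Γ : Type*} [AddCommGroup Γ]

/-- The element `q ^ γ` of `A`. -/
def qpow (R : Subring ℂ) {Γ : Type*} [AddCommGroup Γ] (γ : Γ) : Coeff R Γ :=
  AddMonoidAlgebra.single γ 1

/-- The bar involution of `A`, sending `q ^ γ` to `q ^ (-γ)`. -/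
def barA (R : Subring ℂ) (Γ : Type*) [AddCommGroup Γ] : Coeff R Γ →+* Coeff R Γ :=
  (AddMonoidAlgebra.domCongr R R (AddEquiv.neg Γ) : Coeff R Γ →+* Coeff R Γ)

/-- `a ∈ A_{≥ 0}`: only powers `q ^ γ` with `γ ≥ 0` occur in `a`. -/
def IsNonneg [LinearOrder Γ] (a : Coeff R Γ) : Prop := ∀ γ : Γ, a.coeff γ ≠ 0 → 0 ≤ γ

/-- `a ∈ A_{> 0}`: only powers `q ^ γ` with `γ > 0` occur in `a`. -/
def IsPos [LinearOrder Γ] (a : Coeff R Γ) : Prop := ∀ γ : Γ, a.coeff γ ≠ 0 → 0 < γ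

lemma qpow_mul_qpow (γ δ : Γ) : qpow R γ * qpow R δ = qpow R (γ + δ) := by
  simp [qpow, AddMonoidAlgebra.single_mul_single]

lemma qpow_zero : qpow R (0 : Γ) = 1 := rfl

lemma barA_qpow (γ : Γ) : barA R Γ (qpow R γ) = qpow R (-γ) := by
  simp [barA, qpow]

end Coeff

/-! ### Coxeter groups -/

section Coxeter

variable {B W : Type*} [Group W] {M : CoxeterMatrix B} (cs : CoxeterSystem M W)

/-- The sign `ε_w = (-1) ^ ℓ(w)`. -/
def sgn (cs : CoxeterSystem M W) (R : Subring ℂ) (Γ : Type*) [AddCommGroup Γ] (w : W) :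
    Coeff R Γ := (-1) ^ cs.length w

/-- The Bruhat order `y ≤ w`: there is a chain `y = x₀, x₁, …, xₙ = w` in which each `xᵢ₊₁` is
`t xᵢ` for a reflection `t`, with `ℓ(xᵢ) < ℓ(xᵢ₊₁)`. -/
def BruhatLE (y w : W) : Prop :=
  Relation.ReflTransGen
    (fun x z : W => ∃ t : W, cs.IsReflection t ∧ z = t * x ∧ cs.length x < cs.length z) y w

/-- The strict Bruhat order. -/
def BruhatLT (y w : W) : Prop := BruhatLE cs y w ∧ y ≠ w

/-- The left weak order: `x ≤_L y` if and only if `x` is a suffix of `y`. -/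
def LeftWeakLE (x y : W) : Prop :=
  ∃ z : W, y = z * x ∧ cs.length y = cs.length z + cs.length x

/-- The set `D_J` of minimal coset representatives. -/
def minReps (J : Set B) : Set W :=
  {w | ∀ j ∈ J, cs.length w < cs.length (w * cs.simple j)}

/-- A weight function `L ≥ 0`, given by its values on the simple reflections: these are
nonnegative and agree on simple reflections that are conjugate in `W`. -/
structure IsWeight {Γ : Type*} [AddCommGroup Γ] [LinearOrder Γ] (L : B → Γ) : Prop where
  conj : ∀ i j : B, IsConj (cs.simple i) (cs.simple j) → L i = L j
  nonneg : ∀ i : B, 0 ≤ L i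

end Coxeter

/-! ### The Hecke algebra -/

section Hecke

variable {B : Type*} (M : CoxeterMatrix B) (R : Subring ℂ) {Γ : Type*} [AddCommGroup Γ] (L : B → Γ)

/-- The defining relations of the Hecke algebra: the quadratic relations
`T_s ^ 2 = 1 + (q ^ L(s) - q ^ (-L(s))) T_s` and the braid relations. (If `s s'` has infinite order
then `M i j = 0`, both words are empty and the braid relation is void.) -/
inductive HeckeRel : FreeAlgebra (Coeff R Γ) B → FreeAlgebra (Coeff R Γ) B → Prop
  | quadratic (i : B) :
      HeckeRel (FreeAlgebra.ι _ i * FreeAlgebra.ι _ i)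
        (1 + (qpow R (L i) - qpow R (-L i)) • FreeAlgebra.ι _ i)
  | braid (i j : B) :
      HeckeRel ((CoxeterSystem.braidWord M i j).map (FreeAlgebra.ι _)).prod
        ((CoxeterSystem.braidWord M j i).map (FreeAlgebra.ι _)).prod

/-- The generic Hecke algebra of the Coxeter group with matrix `M`, with parameters `q ^ L(s)`:
the `A`-algebra with generators `T_s` subject to the quadratic and the braid relations. -/
def Hecke : Type _ := RingQuot (HeckeRel M R L)

instance : Semiring (Hecke M R L) := inferInstanceAs (Semiring (RingQuot (HeckeRel M R L)))

instance : Algebra (Coeff R Γ) (Hecke M R L) :=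
  inferInstanceAs (Algebra (Coeff R Γ) (RingQuot (HeckeRel M R L)))

instance : Ring (Hecke M R L) := Algebra.semiringToRing (Coeff R Γ)

namespace Hecke

/-- The generator `T_s` of the Hecke algebra. -/
def T (i : B) : Hecke M R L := RingQuot.mkAlgHom (Coeff R Γ) (HeckeRel M R L) (FreeAlgebra.ι _ i)

/-- The inverse of `T_s`, namely `T_s + (q ^ (-L(s)) - q ^ L(s))`. -/
def Tinv (i : B) : Hecke M R L :=
  T M R L i + algebraMap (Coeff R Γ) (Hecke M R L) (qpow R (-L i) - qpow R (L i))

lemma T_mul_T (i : B) :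
    T M R L i * T M R L i = 1 + (qpow R (L i) - qpow R (-L i)) • T M R L i := by
  have h := RingQuot.mkAlgHom_rel (Coeff R Γ) (HeckeRel.quadratic (M := M) (R := R) (L := L) i)
  rw [map_mul, map_add, map_one, map_smul] at h
  exact h

lemma T_mul_Tinv (i : B) : T M R L i * Tinv M R L i = 1 := by
  rw [Tinv, mul_add, T_mul_T, ← Algebra.commutes, ← Algebra.smul_def, add_assoc, ← add_smul]
  simp

lemma Tinv_mul_T (i : B) : Tinv M R L i * T M R L i = 1 := by
  rw [Tinv, add_mul, T_mul_T, ← Algebra.smul_def, add_assoc, ← add_smul]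
  simp

lemma Tinv_mul_Tinv (i : B) :
    Tinv M R L i * Tinv M R L i = 1 + (qpow R (-L i) - qpow R (L i)) • Tinv M R L i := by
  nth_rw 1 [Tinv]
  rw [add_mul, T_mul_Tinv, ← Algebra.smul_def]

/-- `T_s` as a unit. -/
def unitT (i : B) : (Hecke M R L)ˣ :=
  ⟨T M R L i, Tinv M R L i, T_mul_Tinv M R L i, Tinv_mul_T M R L i⟩

lemma braid_T (i j : B) :
    ((CoxeterSystem.braidWord M i j).map (T M R L)).prod =
      ((CoxeterSystem.braidWord M j i).map (T M R L)).prod := by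
  have h := RingQuot.mkAlgHom_rel (Coeff R Γ) (HeckeRel.braid (M := M) (R := R) (L := L) i j)
  rw [map_list_prod, map_list_prod, List.map_map, List.map_map] at h
  exact h

lemma reverse_alternatingWord (i j : B) (m : ℕ) :
    (CoxeterSystem.alternatingWord i j m).reverse =
      if Even m then CoxeterSystem.alternatingWord j i m
      else CoxeterSystem.alternatingWord i j m := by
  induction m generalizing i j with
  | zero => simp [CoxeterSystem.alternatingWord]
  | succ m ih =>
    rw [CoxeterSystem.alternatingWord_succ, List.concat_eq_append, List.reverse_append, ih,
      List.reverse_singleton, List.singleton_append]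
    rcases Nat.even_or_odd m with h | h
    · have h' : ¬ Even (m + 1) := by simpa [Nat.even_add_one] using h
      rw [if_pos h, if_neg h', ← List.concat_eq_append, ← CoxeterSystem.alternatingWord_succ,
        CoxeterSystem.alternatingWord_succ', if_pos h]
    · have h0 : ¬ Even m := Nat.not_even_iff_odd.mpr h
      have h' : Even (m + 1) := by simpa [Nat.even_add_one] using h0
      rw [if_neg h0, if_pos h', CoxeterSystem.alternatingWord_succ', if_neg h0]

lemma prod_map_Tinv (l : List B) :
    (l.map (Tinv M R L)).prod = (((l.reverse.map (unitT M R L)).prod⁻¹ : (Hecke M R L)ˣ) :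
      Hecke M R L) := by
  induction l with
  | nil => simp
  | cons a l ih =>
    rw [List.map_cons, List.prod_cons, ih]
    simp [mul_inv_rev, unitT]

lemma braid_Tinv (i j : B) :
    ((CoxeterSystem.braidWord M i j).map (Tinv M R L)).prod =
      ((CoxeterSystem.braidWord M j i).map (Tinv M R L)).prod := by
  have h : ((CoxeterSystem.braidWord M i j).map (unitT M R L)).prod =
      ((CoxeterSystem.braidWord M j i).map (unitT M R L)).prod := by
    apply Units.ext
    have := braid_T M R L i j
    rw [← Units.coeHom_apply, ← Units.coeHom_apply, map_list_prod, map_list_prod,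
      List.map_map, List.map_map]
    exact this
  rw [prod_map_Tinv, prod_map_Tinv]
  simp only [CoxeterSystem.braidWord] at h ⊢
  rw [reverse_alternatingWord, reverse_alternatingWord, M.symmetric j i] at *
  split_ifs
  · rw [h]
  · rw [h]

/-- The structure of an `A`-algebra on the Hecke algebra in which `a` acts as `\bar a`. -/
abbrev barAlgebra : Algebra (Coeff R Γ) (Hecke M R L) :=
  ((algebraMap (Coeff R Γ) (Hecke M R L)).comp (barA R Γ)).toAlgebra'
    (fun c x => Algebra.commutes (barA R Γ c) x)

/-- The ring homomorphism from the free algebra that restricts to the bar involution of `A` and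
sends the generator indexed by `s` to `T_s⁻¹`. -/
def barFree : FreeAlgebra (Coeff R Γ) B →+* Hecke M R L :=
  letI := barAlgebra M R L
  (FreeAlgebra.lift (Coeff R Γ) (Tinv M R L)).toRingHom

lemma barFree_ι (i : B) : barFree M R L (FreeAlgebra.ι _ i) = Tinv M R L i := by
  let _ := barAlgebra M R L
  exact FreeAlgebra.lift_ι_apply (Tinv M R L) i

lemma barFree_algebraMap (a : Coeff R Γ) :
    barFree M R L (algebraMap _ _ a) = algebraMap (Coeff R Γ) (Hecke M R L) (barA R Γ a) := by
  let _ := barAlgebra M R L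
  exact (FreeAlgebra.lift (Coeff R Γ) (Tinv M R L)).commutes a

lemma barFree_rel ⦃x y : FreeAlgebra (Coeff R Γ) B⦄ (h : HeckeRel M R L x y) :
    barFree M R L x = barFree M R L y := by
  cases h with
  | quadratic i =>
    rw [Algebra.smul_def, map_mul, map_add, map_one, map_mul, barFree_ι, barFree_algebraMap,
      map_sub, barA_qpow, barA_qpow, neg_neg, ← Algebra.smul_def, Tinv_mul_Tinv]
  | braid i j =>
    have h : ⇑(barFree M R L) ∘ FreeAlgebra.ι (Coeff R Γ) = Tinv M R L :=
      funext (barFree_ι M R L)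
    rw [map_list_prod, map_list_prod, List.map_map, List.map_map, h, braid_Tinv]

/-- The bar involution of the Hecke algebra, as a ring endomorphism: it restricts to the bar
involution of `A` and sends `T_s` to `T_s⁻¹`. -/
def bar : Hecke M R L →+* Hecke M R L :=
  RingQuot.lift ⟨barFree M R L, barFree_rel M R L⟩

lemma liftNeg_rel ⦃x y : FreeAlgebra (Coeff R Γ) B⦄ (h : HeckeRel M R L x y) :
    FreeAlgebra.lift (Coeff R Γ) (fun i => -Tinv M R L i) x =
      FreeAlgebra.lift (Coeff R Γ) (fun i => -Tinv M R L i) y := by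
  cases h with
  | quadratic i =>
    rw [map_mul, map_add, map_one, map_smul, FreeAlgebra.lift_ι_apply, neg_mul_neg, Tinv_mul_Tinv,
      smul_neg, ← neg_smul, neg_sub]
  | braid i j =>
    have h : ⇑(FreeAlgebra.lift (Coeff R Γ) (fun i => -Tinv M R L i)) ∘
        FreeAlgebra.ι (Coeff R Γ) = Neg.neg ∘ Tinv M R L :=
      funext fun i => FreeAlgebra.lift_ι_apply _ i
    rw [map_list_prod, map_list_prod, List.map_map, List.map_map, h, ← List.map_map,
      ← List.map_map, List.prod_map_neg, List.prod_map_neg, braid_Tinv, List.length_map,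
      List.length_map, CoxeterSystem.length_alternatingWord, CoxeterSystem.length_alternatingWord,
      M.symmetric j i]

/-- The `A`-algebra endomorphism `Φ` with `Φ(T_w) = ε_w \overline{T_w}` for all `w`: on the
generators it is given by `Φ(T_s) = -\overline{T_s} = -T_s⁻¹`. -/
def Phi : Hecke M R L →ₐ[Coeff R Γ] Hecke M R L :=
  RingQuot.liftAlgHom (Coeff R Γ)
    ⟨FreeAlgebra.lift (Coeff R Γ) (fun i => -Tinv M R L i), liftNeg_rel M R L⟩

lemma bar_algebraMap (a : Coeff R Γ) :
    bar M R L (algebraMap _ _ a) = algebraMap (Coeff R Γ) (Hecke M R L) (barA R Γ a) := by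
  rw [← barFree_algebraMap, show algebraMap (Coeff R Γ) (Hecke M R L) a = _ from
    ((RingQuot.mkAlgHom (Coeff R Γ) (HeckeRel M R L)).commutes a).symm, ← AlgHom.coe_toRingHom, RingQuot.mkAlgHom_coe]
  exact RingQuot.lift_mkRingHom_apply _ _ _

lemma bar_T (i : B) : bar M R L (T M R L i) = Tinv M R L i := by
  rw [← barFree_ι, T, ← AlgHom.coe_toRingHom, RingQuot.mkAlgHom_coe]
  exact RingQuot.lift_mkRingHom_apply _ _ _

lemma Phi_T (i : B) : Phi M R L (T M R L i) = -bar M R L (T M R L i) := by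
  rw [bar_T]
  exact (RingQuot.liftAlgHom_mkAlgHom_apply _ _ _ _).trans (FreeAlgebra.lift_ι_apply _ i)

end Hecke

end Hecke

/-! ### W-graph ideals and their modules -/

section Ideal

variable {B W : Type*} [Group W] {M : CoxeterMatrix B} (cs : CoxeterSystem M W)
  (E : Set W) (J : Set B)

/-- `E` is a (nonempty) ideal of `(W, ≤_L)` and `J ⊆ Pos(E)`, that is, `E ⊆ D_J`. -/
structure IsIdealWith : Prop where
  suffix_mem : ∀ w ∈ E, ∀ u : W, LeftWeakLE cs u w → u ∈ E
  one_mem : 1 ∈ E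
  subset_minReps : E ⊆ minReps cs J

/-- `s` is a strong ascent of `w ∈ E`. -/
def StrongAscent (i : B) (w : W) : Prop :=
  cs.length w < cs.length (cs.simple i * w) ∧ cs.simple i * w ∈ E

/-- `s` is a strong descent of `w ∈ E`. -/
def StrongDescent (i : B) (w : W) : Prop :=
  cs.length (cs.simple i * w) < cs.length w ∧ cs.simple i * w ∈ E

/-- `s` is a weak descent of `w ∈ E`. -/
def WeakDescent (i : B) (w : W) : Prop :=
  cs.length w < cs.length (cs.simple i * w) ∧ cs.simple i * w ∉ minReps cs J

/-- `s` is a weak ascent of `w ∈ E`. -/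
def WeakAscent (i : B) (w : W) : Prop :=
  cs.length w < cs.length (cs.simple i * w) ∧ cs.simple i * w ∈ minReps cs J \ E

variable (R : Subring ℂ) {Γ : Type*} [AddCommGroup Γ] [LinearOrder Γ] (L : B → Γ)

/-- The data exhibiting `E = E_J` as a `W`-graph ideal with respect to `J` and `L`, with
`N = M(E_J, L)`: the basis `Γ_w`, the polynomials `r^s_{z,w}` (written `r s w z`, and relevant only
when `s` is a weak ascent of `w`) and the bar involution of `N`. -/
structure IdealModule (N : Type*) [AddCommGroup N] [Module (Coeff R Γ) N] [Module (Hecke M R L) N]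
    [IsScalarTower (Coeff R Γ) (Hecke M R L) N] where
  isIdeal : IsIdealWith cs E J
  basis : Module.Basis E (Coeff R Γ) N
  r : B → E → E →₀ Coeff R Γ
  r_pos : ∀ (i : B) (w : E), WeakAscent cs E J i w → ∀ z : E,
    ∃ a : Coeff R Γ, IsPos a ∧ r i w z = qpow R (L i) * a
  r_lt : ∀ (i : B) (w : E), WeakAscent cs E J i w → ∀ z : E, r i w z ≠ 0 → BruhatLT cs z.1 w.1
  T_strongDescent : ∀ (i : B) (w : E) (h : StrongDescent cs E i w),
    Hecke.T M R L i • basis w =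
      basis ⟨cs.simple i * w, h.2⟩ + (qpow R (L i) - qpow R (-L i)) • basis w
  T_strongAscent : ∀ (i : B) (w : E) (h : StrongAscent cs E i w),
    Hecke.T M R L i • basis w = basis ⟨cs.simple i * w, h.2⟩
  T_weakDescent : ∀ (i : B) (w : E), WeakDescent cs J i w →
    Hecke.T M R L i • basis w = -(qpow R (-L i) • basis w)
  T_weakAscent : ∀ (i : B) (w : E), WeakAscent cs E J i w →
    Hecke.T M R L i • basis w = qpow R (L i) • basis w - (r i w).sum fun z a => a • basis z
  bar : N →ₛₗ[barA R Γ] N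
  bar_bar : ∀ x : N, bar (bar x) = x
  bar_basis_one : bar (basis ⟨1, isIdeal.one_mem⟩) = basis ⟨1, isIdeal.one_mem⟩
  bar_smul : ∀ (h : Hecke M R L) (x : N), bar (h • x) = Hecke.bar M R L h • bar x

/-- The dual module `\tilde M(E_J, L)` of `M(E_J, L)`: the basis `\tilde Γ_w` and the bar
involution. The action involves `\tilde r^s_{z,w} = ε_z ε_w \overline{r^s_{z,w}}`. -/
structure DualModule {cs : CoxeterSystem M W} {E : Set W} {J : Set B} {R : Subring ℂ} {L : B → Γ}
    {N : Type*} [AddCommGroup N] [Module (Coeff R Γ) N] [Module (Hecke M R L) N]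
    [IsScalarTower (Coeff R Γ) (Hecke M R L) N] (D : IdealModule cs E J R L N)
    (N' : Type*) [AddCommGroup N'] [Module (Coeff R Γ) N'] [Module (Hecke M R L) N']
    [IsScalarTower (Coeff R Γ) (Hecke M R L) N'] where
  basis : Module.Basis E (Coeff R Γ) N'
  T_strongDescent : ∀ (i : B) (w : E) (h : StrongDescent cs E i w),
    Hecke.T M R L i • basis w =
      basis ⟨cs.simple i * w, h.2⟩ + (qpow R (L i) - qpow R (-L i)) • basis w
  T_strongAscent : ∀ (i : B) (w : E) (h : StrongAscent cs E i w),
    Hecke.T M R L i • basis w = basis ⟨cs.simple i * w, h.2⟩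
  T_weakDescent : ∀ (i : B) (w : E), WeakDescent cs J i w →
    Hecke.T M R L i • basis w = qpow R (L i) • basis w
  T_weakAscent : ∀ (i : B) (w : E), WeakAscent cs E J i w →
    Hecke.T M R L i • basis w = -(qpow R (-L i) • basis w) +
      (D.r i w).sum fun z a => (sgn cs R Γ z * sgn cs R Γ w * barA R Γ a) • basis z
  bar : N' →ₛₗ[barA R Γ] N'
  bar_bar : ∀ x : N', bar (bar x) = x
  bar_basis_one : bar (basis ⟨1, D.isIdeal.one_mem⟩) = basis ⟨1, D.isIdeal.one_mem⟩
  bar_smul : ∀ (h : Hecke M R L) (x : N'), bar (h • x) = Hecke.bar M R L h • bar x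

end Ideal

/-! ### Kazhdan–Lusztig families -/

section KL

variable {B W : Type*} [Group W] {M : CoxeterMatrix B} (cs : CoxeterSystem M W)
  {E : Set W} {R : Subring ℂ} {Γ : Type*} [AddCommGroup Γ] [LinearOrder Γ]
  {N : Type*} [AddCommGroup N] [Module (Coeff R Γ) N]

/-- The conditions on the coefficients `P_{y,w}` (written `P w y`): `P_{y,w} ∈ A_{≥ 0}`,
`P_{y,w} = 0` unless `y ≤ w`, `P_{w,w} = 1`, and `P_{y,w}` has zero constant term if `y ≠ w`. -/
structure IsKLCoeff (P : E → E →₀ Coeff R Γ) : Prop where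
  nonneg : ∀ y w : E, IsNonneg (P w y)
  triangular : ∀ y w : E, ¬ BruhatLE cs y.1 w.1 → P w y = 0
  diagonal : ∀ w : E, P w w = 1
  constant_term : ∀ y w : E, y ≠ w → (P w y).coeff 0 = 0

/-- The matrix `P_{y,w}` of coordinates of a family `C_w` in a basis. -/
def coords (b : Module.Basis E (Coeff R Γ) N) (C : E → N) : E → E →₀ Coeff R Γ :=
  fun w => b.repr (C w)

/-- The property that characterizes the family `C_w = ∑_y P_{y,w} Γ_y` attached to a basis `Γ_y`
and a bar involution. -/
structure IsKLFamily (b : Module.Basis E (Coeff R Γ) N) (bar : N → N) (C : E → N) : Prop where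
  bar_eq : ∀ w, bar (C w) = C w
  coeff : IsKLCoeff cs (coords b C)

/-- The property of a family `c_w = ∑_y ε_y \overline{p_{y,w}} Γ_y` to be invariant under the bar
involution, with coefficients `p_{y,w}` that satisfy the Kazhdan–Lusztig conditions. -/
structure IsDualKLFamily (b : Module.Basis E (Coeff R Γ) N) (bar : N → N) (c : E → N)
    (p : E → E →₀ Coeff R Γ) : Prop where
  bar_eq : ∀ w, bar (c w) = c w
  expansion : ∀ w, c w = (p w).sum fun y a => (sgn cs R Γ y * barA R Γ a) • b y
  coeff : IsKLCoeff cs p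

open Classical in
/-- The recursion `\overline{P_{y,w}} - P_{y,w} = ∑_{y < x ≤ w} \overline{R_{y,x}} P_{x,w}` for all
`y < w`, with `R_{y,x}` written `Rm x y`. For fixed `w` only finitely many `P_{x,w}` are nonzero,
and the sum is taken over the corresponding `x`. -/
def Recursion (Rm P : E → E →₀ Coeff R Γ) : Prop :=
  ∀ y w : E, BruhatLT cs y.1 w.1 →
    barA R Γ (P w y) - P w y =
      ∑ x ∈ (P w).support with BruhatLT cs y.1 x.1 ∧ BruhatLE cs x.1 w.1,
        barA R Γ (Rm x y) * P w x

end KL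

end WGraph

end

open WGraph

universe u v

/-!
The central object is the semilinear map `signTwist : Γ_w ↦ ε_w \tilde Γ_w`. The formulas for the
action on a dual module say exactly that it anticommutes with every `T_s`
(`DualModule.signTwist_T_smul`). Its composition `Γ_w ↦ ε_w \overline{\tilde Γ_w}` with the bar
involution is therefore linear and turns the action of `T_s` into that of `Φ(T_s) = -T_s⁻¹`: this is
`η`, and `θ` is obtained in the same way from the inverse `\tilde Γ_w ↦ ε_w Γ_w`. Both are unique,
and inverse to each other, because `Γ_w = T_w Γ_1` for all `w` in the ideal
(`linearMap_ext_of_T`). Read backwards, the same computation constructs a dual module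
(`dualModule`): let `H` act on `M` through `Φ` and put `\tilde Γ_w = ε_w \overline{Γ_w}`.

The Kazhdan–Lusztig families exist and are unique because the bar involutions are unitriangular
for the Bruhat order (`isUnitriangular_bar`). This is an induction along `Γ_{sw} = T_s Γ_w`,
with the lifting property `BruhatLE.simple_mul_le` as its combinatorial content; the lifting
property follows from the strong exchange condition, here in the form `invParity_ne_zero_iff`: an
action of `W` on `W × ℤ/2` detects the inversions of an element. Bruhat intervals need not be known
to be finite: `\overline{Γ_w} - Γ_w` is a finite combination `d` of the `Γ_y` with `y < w`, and
removing the coefficients of maximal length repeatedly writes `d` as `u - \bar u` with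
coefficients of `u` in `A_{> 0}` (`exists_sub_bar_eq`), so that `C_w = Γ_w + u`.

Finally, since `θ` and `η` are mutually inverse, `signTwist` commutes with the bar involutions
(`signTwist_bar_comm`). It therefore agrees with `η`, respectively `θ`, on bar-invariant elements
and matches Kazhdan–Lusztig families on one side with dual families on the other (`IsKLFamily.dual`).
-/

noncomputable section

namespace WGraph

/-! ### Inversions and the Bruhat order -/

section Bruhat

variable {B W : Type*} [Group W] {M : CoxeterMatrix B} (cs : CoxeterSystem M W)

lemma end_mul_apply {α : Type*} (f g : Function.End α) (a : α) : (f * g) a = f (g a) := rfl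

open Classical in
/-- The action of the simple reflection `s` on `W × ℤ/2` that conjugates the first coordinate by
`s` and changes the second one exactly at `s`. -/
def reflStep (i : B) : Function.End (W × ZMod 2) := fun p =>
  (cs.simple i * p.1 * cs.simple i, p.2 + if p.1 = cs.simple i then 1 else 0)

open Classical in
lemma reflStep_mul_pow (i j : B) (n : ℕ) (p : W × ZMod 2) :
    ((reflStep cs i * reflStep cs j) ^ n) p =
      ((cs.simple i * cs.simple j) ^ n * p.1 * ((cs.simple i * cs.simple j) ^ n)⁻¹,
        p.2 + ∑ k ∈ Finset.range (2 * n),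
          if p.1 = cs.simple j * (cs.simple i * cs.simple j) ^ k then 1 else 0) := by
  induction n with
  | zero => simp; rfl
  | succ n ih =>
    set c := cs.simple i * cs.simple j with hc
    have hci : c⁻¹ = cs.simple j * cs.simple i := by simp [hc]
    -- `s_j` inverts `c = s_i s_j`
    have hinv : ∀ k : ℕ, cs.simple j * c ^ k = (c ^ k)⁻¹ * cs.simple j := by
      intro k
      have h1 : cs.simple j * c * (cs.simple j)⁻¹ = c⁻¹ := by simp [hc, mul_assoc]
      have h2 : cs.simple j * c ^ k * (cs.simple j)⁻¹ = (c⁻¹) ^ k := by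
        rw [← h1, conj_pow]
      rw [← inv_pow, ← h2]; simp [mul_assoc]
    have e1 : (c ^ n * p.1 * (c ^ n)⁻¹ = cs.simple j) ↔ p.1 = cs.simple j * c ^ (2 * n) := by
      rw [two_mul, pow_add, ← mul_assoc, hinv]
      constructor
      · intro h; rw [← h]; group
      · intro h; rw [h]; group
    have e2 : (cs.simple j * (c ^ n * p.1 * (c ^ n)⁻¹) * cs.simple j = cs.simple i) ↔
        p.1 = cs.simple j * c ^ (2 * n + 1) := by
      have : cs.simple j * c ^ (2 * n + 1) =
          (c ^ n)⁻¹ * (cs.simple j * cs.simple i * cs.simple j) * c ^ n := by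
        rw [show 2 * n + 1 = n + 1 + n by ring, pow_add, pow_succ, ← mul_assoc, ← mul_assoc,
          hinv, hc]
        group
      rw [this]
      constructor
      · intro h; rw [← h]; simp [mul_assoc]
      · intro h; rw [h]; simp [mul_assoc]
    rw [pow_succ', end_mul_apply, ih, end_mul_apply]
    simp only [reflStep]
    rw [Prod.mk.injEq]
    constructor
    · rw [pow_succ', mul_inv_rev, hci]; simp only [hc, mul_assoc]
    · rw [show 2 * (n + 1) = 2 * n + 1 + 1 by ring, Finset.sum_range_succ, Finset.sum_range_succ]
      simp only [e1, e2, add_assoc]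

lemma reflStep_isLiftable : M.IsLiftable (reflStep cs) := by
  classical
  intro i j
  funext p
  rw [reflStep_mul_pow, cs.simple_mul_simple_pow, two_mul, Finset.sum_range_add]
  simp only [pow_add, cs.simple_mul_simple_pow, one_mul, CharTwo.add_self_eq_zero]
  simp; rfl

/-- The action of `W` on `W × ℤ/2` in which `s` acts by `reflStep`. -/
def reflAction : W →* Function.End (W × ZMod 2) :=
  cs.lift ⟨reflStep cs, reflStep_isLiftable cs⟩

/-- The change of the second coordinate in the action of `w` at `t`. If `t` is a reflection, then
it is `1` or `0` according to whether or not `ℓ (w t) < ℓ w`. -/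
def invParity (w t : W) : ZMod 2 := (reflAction cs w (t, 0)).2

lemma reflAction_simple (i : B) : reflAction cs (cs.simple i) = reflStep cs i :=
  cs.lift_apply_simple _ i

lemma reflAction_apply (w : W) (p : W × ZMod 2) :
    reflAction cs w p = (w * p.1 * w⁻¹, p.2 + invParity cs w p.1) := by
  classical
  suffices h : ∀ w : W, ∃ f : W → ZMod 2, ∀ p, reflAction cs w p = (w * p.1 * w⁻¹, p.2 + f p.1) by
    obtain ⟨f, hf⟩ := h w
    rw [invParity, hf, hf, zero_add]
  intro w
  induction w using cs.simple_induction_left with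
  | one => exact ⟨0, fun p => by rw [map_one]; simp; rfl⟩
  | mul_simple_left w i ih =>
    obtain ⟨f, hf⟩ := ih
    refine ⟨fun t => f t + if w * t * w⁻¹ = cs.simple i then 1 else 0, fun p => ?_⟩
    rw [map_mul, end_mul_apply, hf, reflAction_simple]
    simp [reflStep, mul_assoc, add_assoc]

lemma invParity_mul (v w t : W) :
    invParity cs (v * w) t = invParity cs w t + invParity cs v (w * t * w⁻¹) := by
  have h : reflAction cs (v * w) (t, 0) = reflAction cs v (reflAction cs w (t, 0)) := by
    rw [map_mul]; rfl
  rw [invParity, h, reflAction_apply cs v, reflAction_apply cs w]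
  simp

open Classical in
lemma invParity_simple (i : B) (t : W) :
    invParity cs (cs.simple i) t = if t = cs.simple i then 1 else 0 := by
  rw [invParity, reflAction_simple]
  simp [reflStep]

lemma invParity_one (t : W) : invParity cs 1 t = 0 := by
  rw [invParity, map_one]; rfl

lemma invParity_self {t : W} (ht : cs.IsReflection t) : invParity cs t t = 1 := by
  classical
  obtain ⟨u, i, rfl⟩ := ht
  have h := invParity_mul cs u u⁻¹ (u * cs.simple i * u⁻¹)
  rw [mul_inv_cancel, invParity_one] at h
  have e : u⁻¹ * (u * cs.simple i * u⁻¹) * u⁻¹⁻¹ = cs.simple i := by simp [mul_assoc]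
  rw [e] at h
  rw [invParity_mul, e, invParity_mul, invParity_simple, if_pos rfl]
  have e' : cs.simple i * cs.simple i * (cs.simple i)⁻¹ = cs.simple i := by simp
  rw [e']
  linear_combination -h

lemma mem_rightInvSeq_of_invParity_ne_zero (l : List B) (t : W)
    (h : invParity cs (cs.wordProd l) t ≠ 0) : t ∈ cs.rightInvSeq l := by
  classical
  induction l with
  | nil => exact absurd (invParity_one cs t) (by simpa using h)
  | cons i l ih =>
    rw [cs.wordProd_cons, invParity_mul, invParity_simple] at h
    rw [CoxeterSystem.rightInvSeq, List.mem_cons]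
    by_cases h' : cs.wordProd l * t * (cs.wordProd l)⁻¹ = cs.simple i
    · left; rw [← h']; group
    · rw [if_neg h', add_zero] at h
      exact Or.inr (ih h)

/-- The strong exchange condition, in the form of a description of the inversions of `w`. -/
lemma invParity_ne_zero_iff {t : W} (ht : cs.IsReflection t) (w : W) :
    invParity cs w t ≠ 0 ↔ cs.length (w * t) < cs.length w := by
  have key : ∀ w : W, invParity cs w t ≠ 0 → cs.length (w * t) < cs.length w := by
    intro w h
    obtain ⟨l, hl, rfl⟩ := cs.exists_isReduced w
    exact (cs.isRightInversion_of_mem_rightInvSeq hl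
      (mem_rightInvSeq_of_invParity_ne_zero cs l t h)).2
  refine ⟨key w, fun h h0 => ?_⟩
  have h1 := invParity_mul cs w t t
  rw [invParity_self cs ht, mul_inv_cancel_right, h0, add_zero] at h1
  have h2 := key (w * t) (by rw [h1]; exact one_ne_zero)
  rw [mul_assoc, ht.mul_self, mul_one] at h2
  exact lt_asymm h h2

/-- Multiplication by a simple reflection `s` preserves the direction of every edge `x → t x` of
the Bruhat graph with `t ≠ s`. -/
lemma length_simple_mul_lt {t : W} (ht : cs.IsReflection t) {x : W} {i : B} (hne : t ≠ cs.simple i)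
    (h : cs.length x < cs.length (t * x)) :
    cs.length (cs.simple i * x) < cs.length (cs.simple i * (t * x)) := by
  classical
  set s := cs.simple i
  have hss : s * s = 1 := cs.simple_mul_simple_self i
  have hsi : s⁻¹ = s := cs.inv_simple i
  have h0 : invParity cs x⁻¹ t = 0 := by
    by_contra h0
    have := (invParity_ne_zero_iff cs ht x⁻¹).1 h0
    rw [← cs.length_inv, cs.length_inv x] at this
    simp only [mul_inv_rev, inv_inv, ht.inv] at this
    exact lt_asymm h this
  have ht' : cs.IsReflection (s * t * s⁻¹) := ht.conj s
  have h1 : invParity cs (x⁻¹ * s) (s * t * s⁻¹) = 0 := by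
    rw [invParity_mul, invParity_simple, if_neg]
    · rw [show s * (s * t * s⁻¹) * s⁻¹ = t by
        rw [hsi, ← mul_assoc, ← mul_assoc, hss, one_mul, mul_assoc, hss, mul_one], h0, add_zero]
    · intro e
      apply hne
      have e' : s * t * s⁻¹ = s := e
      rw [mul_inv_eq_iff_eq_mul] at e'
      exact mul_left_cancel e'
  have h2 : ¬ cs.length (x⁻¹ * s * (s * t * s⁻¹)) < cs.length (x⁻¹ * s) := fun h2 =>
    (invParity_ne_zero_iff cs ht' _).2 h2 h1
  have h3 : (x⁻¹ * s * (s * t * s⁻¹))⁻¹ = s * (t * x) := by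
    simp only [mul_inv_rev, inv_inv, ht.inv, hsi]
    simp only [mul_assoc]
    rw [← mul_assoc s s x, hss, one_mul]
  rw [← cs.length_inv (x⁻¹ * s), ← cs.length_inv (x⁻¹ * s * _), h3, mul_inv_rev, inv_inv, hsi] at h2
  refine lt_of_le_of_ne (not_lt.1 h2) fun e => ?_
  have h4 := ht'.length_mul_right_ne (s * x)
  rw [hsi, show s * t * s * (s * x) = s * (t * x) by
    simp only [mul_assoc]; rw [← mul_assoc s s x, hss, one_mul]] at h4
  exact h4 e.symm

lemma BruhatLE.refl (w : W) : BruhatLE cs w w := Relation.ReflTransGen.refl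

variable {cs}

lemma BruhatLE.trans {x y z : W} (h : BruhatLE cs x y) (h' : BruhatLE cs y z) :
    BruhatLE cs x z := Relation.ReflTransGen.trans h h'

lemma BruhatLE.length_lt_or_eq {x y : W} (h : BruhatLE cs x y) :
    cs.length x < cs.length y ∨ x = y := by
  induction h with
  | refl => exact Or.inr rfl
  | tail _ h ih =>
    obtain ⟨t, -, -, hlt⟩ := h
    rcases ih with ih | rfl
    · exact Or.inl (ih.trans hlt)
    · exact Or.inl hlt

lemma BruhatLE.length_le {x y : W} (h : BruhatLE cs x y) : cs.length x ≤ cs.length y := by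
  rcases h.length_lt_or_eq with h | rfl
  exacts [h.le, le_rfl]

lemma BruhatLE.eq_of_length_le {x y : W} (h : BruhatLE cs x y)
    (hl : cs.length y ≤ cs.length x) : x = y :=
  h.length_lt_or_eq.resolve_left hl.not_gt

lemma BruhatLT.length_lt {x y : W} (h : BruhatLT cs x y) : cs.length x < cs.length y :=
  h.1.length_lt_or_eq.resolve_right h.2

lemma BruhatLE.trans_lt {x y z : W} (h : BruhatLE cs x y) (h' : BruhatLT cs y z) :
    BruhatLT cs x z :=
  ⟨h.trans h'.1, fun e => absurd h'.length_lt (by rw [← e]; exact h.length_le.not_gt)⟩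

lemma bruhatLE_simple_mul {w : W} {i : B} (h : cs.length w < cs.length (cs.simple i * w)) :
    BruhatLE cs w (cs.simple i * w) :=
  .single ⟨cs.simple i, cs.isReflection_simple i, rfl, h⟩

lemma simple_mul_bruhatLE {w : W} {i : B} (h : cs.length (cs.simple i * w) < cs.length w) :
    BruhatLE cs (cs.simple i * w) w :=
  .single ⟨cs.simple i, cs.isReflection_simple i, by simp, h⟩

/-- The lifting property of the Bruhat order. -/
lemma BruhatLE.simple_mul_le {y w : W} {i : B} (h : BruhatLE cs y w)
    (hw : cs.length w < cs.length (cs.simple i * w)) :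
    BruhatLE cs (cs.simple i * y) (cs.simple i * w) := by
  suffices H : BruhatLE cs (cs.simple i * y) w ∨
      BruhatLE cs (cs.simple i * y) (cs.simple i * w) from
    H.elim (fun H => H.trans (bruhatLE_simple_mul hw)) id
  clear hw
  induction h with
  | refl => exact Or.inr (BruhatLE.refl cs _)
  | @tail x z hyx hxz ih =>
    obtain ⟨t, ht, rfl, hlt⟩ := hxz
    have hx : BruhatLE cs x (t * x) := .single ⟨t, ht, rfl, hlt⟩
    rcases ih with ih | ih
    · exact Or.inl (ih.trans hx)
    · by_cases hts : t = cs.simple i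
      · left; rw [hts]; exact ih
      · refine Or.inr (ih.trans (.single ⟨cs.simple i * t * (cs.simple i)⁻¹, ht.conj _, ?_,
          length_simple_mul_lt cs ht hts hlt⟩))
        simp [mul_assoc]

end Bruhat

/-! ### The bar involution of the coefficient ring -/

section CoeffBar

variable {R : Subring ℂ} {Γ : Type*} [AddCommGroup Γ]

lemma barA_coeff (a : Coeff R Γ) (γ : Γ) : (barA R Γ a).coeff γ = a.coeff (-γ) := by
  simp [barA, AddMonoidAlgebra.domCongr]

@[simp]
lemma barA_barA (a : Coeff R Γ) : barA R Γ (barA R Γ a) = a := by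
  ext γ; simp [barA_coeff]

variable [LinearOrder Γ]

lemma isPos_zero : IsPos (0 : Coeff R Γ) := fun γ h => absurd (by simp) h

lemma IsPos.isNonneg {a : Coeff R Γ} (ha : IsPos a) : IsNonneg a := fun γ h => (ha γ h).le

lemma IsPos.coeff_zero {a : Coeff R Γ} (ha : IsPos a) : a.coeff 0 = 0 :=
  by_contra fun h => lt_irrefl _ (ha 0 h)

lemma IsNonneg.isPos {a : Coeff R Γ} (ha : IsNonneg a) (h0 : a.coeff 0 = 0) : IsPos a :=
  fun γ h => lt_of_le_of_ne (ha γ h) (by rintro rfl; exact h h0)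

lemma isNonneg_one : IsNonneg (1 : Coeff R Γ) := by
  classical
  intro γ h
  rw [AddMonoidAlgebra.one_def, AddMonoidAlgebra.coeff_single, Finsupp.single_apply] at h
  by_contra h'
  exact h (if_neg (by rintro rfl; exact h' le_rfl))

lemma IsPos.add {a b : Coeff R Γ} (ha : IsPos a) (hb : IsPos b) : IsPos (a + b) := by
  intro γ h
  by_cases h' : a.coeff γ = 0
  · exact hb γ fun h'' => h (by simp [h', h''])
  · exact ha γ h'

lemma IsPos.sub {a b : Coeff R Γ} (ha : IsPos a) (hb : IsPos b) : IsPos (a - b) := by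
  intro γ h
  by_cases h' : a.coeff γ = 0
  · exact hb γ fun h'' => h (by simp [sub_eq_add_neg, h', h''])
  · exact ha γ h'

/-- The part of `a` in `A_{> 0}`. -/
def posPart (a : Coeff R Γ) : Coeff R Γ :=
  AddMonoidAlgebra.ofCoeff (a.coeff.filter fun γ => 0 < γ)

lemma posPart_coeff (a : Coeff R Γ) (γ : Γ) :
    (posPart a).coeff γ = if 0 < γ then a.coeff γ else 0 := by
  simp [posPart, Finsupp.filter_apply]

lemma isPos_posPart (a : Coeff R Γ) : IsPos (posPart a) := by
  intro γ h
  rw [posPart_coeff] at h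
  by_contra h'
  exact h (if_neg h')

@[simp]
lemma posPart_zero : posPart (0 : Coeff R Γ) = 0 := by
  ext γ; simp [posPart_coeff]

variable [IsOrderedAddMonoid Γ]

lemma IsPos.eq_zero_of_barA_eq {a : Coeff R Γ} (ha : IsPos a) (h : barA R Γ a = a) : a = 0 := by
  ext γ
  by_contra h'
  have h1 : 0 < γ := ha γ (by simpa using h')
  have h2 : 0 < -γ := ha (-γ) (by rw [← barA_coeff, h]; simpa using h')
  exact lt_asymm h1 (neg_pos.1 h2)

/-- An element `a` with `\bar a = -a` is determined by its part in `A_{> 0}`. Its constant term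
vanishes because `2` is not a zero divisor in `R`. -/
lemma posPart_sub_barA {a : Coeff R Γ} (h : barA R Γ a = -a) :
    posPart a - barA R Γ (posPart a) = a := by
  have h' : ∀ γ, a.coeff (-γ) = -a.coeff γ := fun γ => by rw [← barA_coeff, h]; simp
  ext γ
  have e : (posPart a - barA R Γ (posPart a)).coeff γ =
      (posPart a).coeff γ - (barA R Γ (posPart a)).coeff γ := by simp [sub_eq_add_neg]
  rw [e, barA_coeff, posPart_coeff, posPart_coeff, h']
  rcases lt_trichotomy 0 γ with hγ | rfl | hγ
  · simp [hγ, hγ.le]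
  · have h0 := h' 0
    rw [neg_zero] at h0
    have : a.coeff 0 = 0 := self_eq_neg.1 h0
    simp [this]
  · simp [hγ, hγ.le]

end CoeffBar

/-! ### Unitriangular maps -/

section Unitriangular

lemma repr_semilinear_apply {ι A N : Type*} [CommRing A] [AddCommGroup N] [Module A N]
    {σ : A →+* A} {b : Module.Basis ι A N} (f : N →ₛₗ[σ] N) (x : N) (y : ι) :
    b.repr (f x) y = (b.repr x).sum fun z a => σ a * b.repr (f (b z)) y := by
  conv_lhs => rw [← b.linearCombination_repr x, Finsupp.linearCombination_apply]
  rw [Finsupp.sum, map_sum, map_sum, Finsupp.finsetSum_apply, Finsupp.sum]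
  refine Finset.sum_congr rfl fun z _ => ?_
  rw [map_smulₛₗ, map_smul]
  rfl

variable {B W : Type*} [Group W] {M : CoxeterMatrix B} (cs : CoxeterSystem M W)
  {E : Set W} {R : Subring ℂ} {Γ : Type*} [AddCommGroup Γ]
  {N : Type*} [AddCommGroup N] [Module (Coeff R Γ) N]

/-- The (semilinear) map `f` is unitriangular with respect to the basis `b` and the Bruhat order:
`f (b w)` is the sum of `b w` and of a combination of the `b y` with `y < w`. -/
structure IsUnitriangular (b : Module.Basis E (Coeff R Γ) N) (f : N → N) : Prop where
  repr_self : ∀ w, b.repr (f (b w)) w = 1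
  le_of_repr_ne_zero : ∀ w y, b.repr (f (b w)) y ≠ 0 → BruhatLE cs y.1 w.1

variable {cs} {b : Module.Basis E (Coeff R Γ) N} {σ : Coeff R Γ →+* Coeff R Γ}

namespace IsUnitriangular

lemma exists_le_of_repr_ne_zero {f : N →ₛₗ[σ] N} (hf : IsUnitriangular cs b f) {x : N} {y : E}
    (h : b.repr (f x) y ≠ 0) : ∃ z, b.repr x z ≠ 0 ∧ BruhatLE cs y.1 z.1 := by
  rw [repr_semilinear_apply] at h
  obtain ⟨z, hz, hz'⟩ := Finset.exists_ne_zero_of_sum_ne_zero h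
  exact ⟨z, Finsupp.mem_support_iff.1 hz, hf.le_of_repr_ne_zero z y (right_ne_zero_of_mul hz')⟩

/-- A unitriangular map only affects the leading coefficients through `σ`. -/
lemma repr_of_length_le {f : N →ₛₗ[σ] N} (hf : IsUnitriangular cs b f) {x : N} {y : E}
    (h : ∀ z, b.repr x z ≠ 0 → cs.length z.1 ≤ cs.length y.1) :
    b.repr (f x) y = σ (b.repr x y) := by
  rw [repr_semilinear_apply, Finsupp.sum_eq_single y]
  · rw [hf.repr_self, mul_one]
  · intro z hz hzy
    by_contra h'
    have hle := hf.le_of_repr_ne_zero z y (right_ne_zero_of_mul h')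
    exact hzy (Subtype.ext (hle.eq_of_length_le (h z hz)).symm)
  · intro _; simp

end IsUnitriangular

lemma exists_maximal_length {x : N} (hx : x ≠ 0) : ∃ y, b.repr x y ≠ 0 ∧
    ∀ z, b.repr x z ≠ 0 → cs.length z.1 ≤ cs.length y.1 := by
  have hne : (b.repr x).support.Nonempty := by
    rw [Finsupp.support_nonempty_iff]
    exact fun h => hx (b.repr.map_eq_zero_iff.1 h)
  obtain ⟨y, hy, hy'⟩ := Finset.exists_max_image _ (fun z : E => cs.length z.1) hne
  exact ⟨y, Finsupp.mem_support_iff.1 hy, fun z hz => hy' z (Finsupp.mem_support_iff.2 hz)⟩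

lemma exists_length_lt (b : Module.Basis E (Coeff R Γ) N) (x : N) :
    ∃ n, ∀ z, b.repr x z ≠ 0 → cs.length z.1 < n :=
  ⟨(b.repr x).support.sup (fun z : E => cs.length z.1) + 1, fun _ hz => Nat.lt_succ_of_le
    (Finset.le_sup (f := fun z : E => cs.length z.1) (Finsupp.mem_support_iff.2 hz))⟩

lemma IsUnitriangular.bijective {f : N →ₗ[Coeff R Γ] N} (hf : IsUnitriangular cs b f) :
    Function.Bijective f := by
  constructor
  · rw [injective_iff_map_eq_zero]
    intro x hx
    by_contra hx'
    obtain ⟨y, hy, hmax⟩ := exists_maximal_length (cs := cs) (b := b) hx'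
    have := hf.repr_of_length_le hmax
    rw [hx] at this
    exact hy (by simpa using this.symm)
  · suffices H : ∀ (n : ℕ) (x : N), (∀ z, b.repr x z ≠ 0 → cs.length z.1 < n) →
        ∃ u, f u = x from fun x => (exists_length_lt b x).elim fun n hn => H n x hn
    intro n
    induction n with
    | zero =>
      intro x hx
      refine ⟨0, ?_⟩
      by_contra hx'
      rw [map_zero] at hx'
      obtain ⟨y, hy, -⟩ := exists_maximal_length (cs := cs) (b := b) (Ne.symm hx')
      exact absurd (hx y hy) (Nat.not_lt_zero _)
    | succ n ih =>
      intro x hx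
      obtain ⟨u, hu⟩ := ih (x - f x) fun z hz => by
        rw [map_sub, Finsupp.sub_apply] at hz
        have hle : cs.length z.1 ≤ n := by
          by_cases h0 : b.repr x z = 0
          · obtain ⟨y, hy, hzy⟩ := hf.exists_le_of_repr_ne_zero (x := x) (y := z)
              (by intro h; exact hz (by rw [h0, h, sub_zero]))
            exact hzy.length_le.trans (Nat.lt_succ_iff.1 (hx y hy))
          · exact Nat.lt_succ_iff.1 (hx z h0)
        refine lt_of_le_of_ne hle fun hn => hz ?_
        rw [hf.repr_of_length_le fun y hy => hn ▸ Nat.lt_succ_iff.1 (hx y hy)]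
        simp
      exact ⟨u + x, by rw [map_add, hu, sub_add_cancel]⟩

end Unitriangular

/-! ### Kazhdan–Lusztig families -/

section KLFamily

variable {B W : Type*} [Group W] {M : CoxeterMatrix B} {cs : CoxeterSystem M W}
  {E : Set W} {R : Subring ℂ} {Γ : Type*} [AddCommGroup Γ] [LinearOrder Γ]
  {N : Type*} [AddCommGroup N] [Module (Coeff R Γ) N] {b : Module.Basis E (Coeff R Γ) N}

lemma IsKLCoeff.isPos {P : E → E →₀ Coeff R Γ} (hP : IsKLCoeff cs P) {y w : E} (h : y ≠ w) :
    IsPos (P w y) := (hP.nonneg y w).isPos (hP.constant_term y w h)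

/-- A Kazhdan–Lusztig family is a basis. -/
lemma IsKLCoeff.exists_basis {C : E → N} (hC : IsKLCoeff cs (coords b C)) :
    ∃ b' : Module.Basis E (Coeff R Γ) N, ∀ w, b' w = C w := by
  have hf : IsUnitriangular cs b (b.constr (Coeff R Γ) C) :=
    ⟨fun w => by rw [b.constr_basis]; exact hC.diagonal w, fun w y h => by
      rw [b.constr_basis] at h
      exact by_contra fun h' => h (hC.triangular y w h')⟩
  exact ⟨b.map (LinearEquiv.ofBijective _ hf.bijective), fun w => by
    rw [Module.Basis.map_apply, LinearEquiv.ofBijective_apply, b.constr_basis]⟩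

variable {bar : N →ₛₗ[barA R Γ] N}

lemma IsKLFamily.recursion (hbar : IsUnitriangular cs b bar) {C : E → N}
    (hC : IsKLFamily cs b bar C) :
    Recursion cs (coords b fun y => bar (b y)) (coords b C) := by
  classical
  intro y w hyw
  have h1 : coords b C w y = (coords b C w).sum fun x a => barA R Γ a * b.repr (bar (b x)) y := by
    rw [coords, ← repr_semilinear_apply, hC.bar_eq]
  have h2 : barA R Γ (coords b C w y) =
      ∑ x ∈ (coords b C w).support, barA R Γ (b.repr (bar (b x)) y) * coords b C w x := by
    conv_lhs => rw [h1, Finsupp.sum, map_sum]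
    refine Finset.sum_congr rfl fun x _ => ?_
    rw [map_mul, barA_barA, mul_comm]
  rw [h2, sub_eq_iff_eq_add, ← Finset.sum_filter_add_sum_filter_not _
    (fun x : E => BruhatLT cs y.1 x.1 ∧ BruhatLE cs x.1 w.1)]
  congr 1
  -- besides the terms with `y < x ≤ w`, only the one with `x = y` can be nonzero
  rw [Finset.sum_eq_single y]
  · rw [hbar.repr_self, map_one, one_mul]
  · intro x hx hxy
    obtain ⟨hx, hx'⟩ := Finset.mem_filter.1 hx
    have hxw : BruhatLE cs x.1 w.1 :=
      by_contra fun h => Finsupp.mem_support_iff.1 hx (hC.coeff.triangular x w h)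
    by_contra h
    refine hx' ⟨⟨hbar.le_of_repr_ne_zero x y fun h0 => h ?_,
      fun e => hxy (Subtype.ext e.symm)⟩, hxw⟩
    rw [h0, map_zero, zero_mul]
  · intro h
    rw [Finset.mem_filter, not_and_not_right] at h
    by_contra h0
    exact (h (Finsupp.mem_support_iff.2 (right_ne_zero_of_mul h0))).1.2 rfl

variable [IsOrderedAddMonoid Γ]

/-- A bar-invariant element all of whose coordinates lie in `A_{> 0}` vanishes. -/
lemma eq_zero_of_bar_eq (hbar : IsUnitriangular cs b bar) {x : N} (hx : bar x = x)
    (hpos : ∀ y, IsPos (b.repr x y)) : x = 0 := by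
  by_contra hx'
  obtain ⟨y, hy, hmax⟩ := exists_maximal_length (cs := cs) (b := b) hx'
  have h := hbar.repr_of_length_le hmax
  rw [hx] at h
  exact hy ((hpos y).eq_zero_of_barA_eq h.symm)

/-- An element `d` with `\bar d = -d` has the form `u - \bar u` with the coordinates of `u` in
`A_{> 0}`. If `d` lies in the span of a set `S` of basis elements that is a lower set for the Bruhat
order, then `u` can be found there too. -/
lemma exists_sub_bar_eq (hbar : IsUnitriangular cs b bar) (hbb : ∀ x, bar (bar x) = x)
    {S : Set E} (hS : ∀ y z : E, z ∈ S → BruhatLE cs y.1 z.1 → y ∈ S) (n : ℕ) (d : N)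
    (hd : bar d = -d) (hlt : ∀ y, b.repr d y ≠ 0 → cs.length y.1 < n)
    (hdS : ∀ y, b.repr d y ≠ 0 → y ∈ S) :
    ∃ u, (∀ y, IsPos (b.repr u y)) ∧ (∀ y, b.repr u y ≠ 0 → y ∈ S) ∧ u - bar u = d := by
  classical
  induction n generalizing d with
  | zero =>
    refine ⟨0, fun y => by simpa using isPos_zero, fun y h => absurd (by simp) h, ?_⟩
    by_contra hd'
    rw [map_zero, sub_zero] at hd'
    obtain ⟨y, hy, -⟩ := exists_maximal_length (cs := cs) (b := b) (Ne.symm hd')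
    exact absurd (hlt y hy) (Nat.not_lt_zero _)
  | succ n ih =>
    -- `v` has the coordinates of maximal length `n` that are wanted for `u`
    let v : N := b.repr.symm
      (((b.repr d).filter fun y : E => cs.length y.1 = n).mapRange posPart posPart_zero)
    have hv : ∀ y, b.repr v y = if cs.length y.1 = n then posPart (b.repr d y) else 0 := by
      intro y
      simp only [v, LinearEquiv.apply_symm_apply, Finsupp.mapRange_apply, Finsupp.filter_apply]
      split_ifs <;> simp
    have hv0 : ∀ y, b.repr v y ≠ 0 → cs.length y.1 = n ∧ b.repr d y ≠ 0 := by
      intro y h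
      rw [hv] at h
      split_ifs at h with h'
      · exact ⟨h', fun h'' => h (by rw [h'', posPart_zero])⟩
      · exact absurd rfl h
    have hvpos : ∀ y, IsPos (b.repr v y) := by
      intro y
      rw [hv]
      split_ifs
      exacts [isPos_posPart _, isPos_zero]
    have key : ∀ y, b.repr (d - (v - bar v)) y ≠ 0 → ∃ z, b.repr d z ≠ 0 ∧
        BruhatLE cs y.1 z.1 := by
      intro y h
      by_contra! h'
      have h1 : b.repr d y = 0 := by_contra fun h1 => h' y h1 (BruhatLE.refl cs _)
      have h2 : b.repr v y = 0 := by_contra fun h2 => (hv0 y h2).2 h1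
      have h3 : b.repr (bar v) y = 0 := by
        by_contra h3
        obtain ⟨z, hz, hyz⟩ := hbar.exists_le_of_repr_ne_zero h3
        exact h' z (hv0 z hz).2 hyz
      exact h (by simp [h1, h2, h3])
    obtain ⟨u, hupos, huS, hu⟩ := ih (d - (v - bar v))
      (by rw [map_sub, map_sub, hbb, hd]; abel)
      (by
        intro y h
        obtain ⟨z, hz, hyz⟩ := key y h
        refine lt_of_le_of_ne (hyz.length_le.trans (Nat.lt_succ_iff.1 (hlt z hz))) fun hn => h ?_
        have hd1 := hbar.repr_of_length_le (x := d) (y := y)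
          fun z hz => hn ▸ Nat.lt_succ_iff.1 (hlt z hz)
        have hv1 := hbar.repr_of_length_le (x := v) (y := y)
          fun z hz => hn ▸ (hv0 z hz).1.le
        rw [hd, map_neg, Finsupp.neg_apply] at hd1
        rw [map_sub, map_sub, Finsupp.sub_apply, Finsupp.sub_apply, hv1, hv, if_pos hn,
          posPart_sub_barA hd1.symm, sub_self])
      (by
        intro y h
        obtain ⟨z, hz, hyz⟩ := key y h
        exact hS y z (hdS z hz) hyz)
    refine ⟨u + v, fun y => ?_, fun y h => ?_, ?_⟩
    · rw [map_add, Finsupp.add_apply]; exact (hupos y).add (hvpos y)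
    · by_cases h' : b.repr u y = 0
      · exact hdS y (hv0 y fun h'' => h (by simp [h', h''])).2
      · exact huS y h'
    · rw [map_add, add_sub_add_comm, hu, sub_add_cancel]

/-- The existence and uniqueness of the Kazhdan–Lusztig family of a unitriangular bar
involution. -/
lemma existsUnique_isKLFamily (hbar : IsUnitriangular cs b bar) (hbb : ∀ x, bar (bar x) = x) :
    ∃! C : E → N, IsKLFamily cs b bar C := by
  have hex : ∀ w : E, ∃ u, (∀ y, IsPos (b.repr u y)) ∧
      (∀ y, b.repr u y ≠ 0 → BruhatLT cs y.1 w.1) ∧ u - bar u = bar (b w) - b w := by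
    intro w
    obtain ⟨n, hn⟩ := exists_length_lt (cs := cs) b (bar (b w) - b w)
    refine exists_sub_bar_eq hbar hbb (S := {y | BruhatLT cs y.1 w.1})
      (fun y z hz hyz => hyz.trans_lt hz) n _ (by rw [map_sub, hbb, neg_sub]) hn fun y h => ?_
    rw [map_sub, Finsupp.sub_apply, b.repr_self] at h
    have hyw : y ≠ w := by
      rintro rfl
      exact h (by rw [hbar.repr_self, Finsupp.single_eq_same, sub_self])
    rw [Finsupp.single_eq_of_ne hyw, sub_zero] at h
    exact ⟨hbar.le_of_repr_ne_zero w y h, fun e => hyw (Subtype.ext e)⟩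
  choose u hpos hlt hu using hex
  have hrep : ∀ w y, b.repr (b w + u w) y = Finsupp.single w 1 y + b.repr (u w) y := by
    intro w y; rw [map_add, Finsupp.add_apply, b.repr_self]
  have huw : ∀ w, b.repr (u w) w = 0 := fun w => by_contra fun h => (hlt w w h).2 rfl
  refine ⟨fun w => b w + u w, ⟨fun w => ?_, ⟨fun y w => ?_, fun y w h => ?_, fun w => ?_,
    fun y w h => ?_⟩⟩, fun C hC => funext fun w => ?_⟩
  · have h := hu w
    rw [sub_eq_sub_iff_add_eq_add] at h
    rw [map_add, ← h, add_comm]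
  · rw [coords, hrep]
    by_cases h : y = w
    · rw [h, huw, Finsupp.single_eq_same, add_zero]; exact isNonneg_one
    · rw [Finsupp.single_eq_of_ne h, zero_add]; exact (hpos w y).isNonneg
  · rw [coords, hrep, Finsupp.single_eq_of_ne (by rintro rfl; exact h (BruhatLE.refl cs _)),
      zero_add]
    exact by_contra fun h' => h (hlt w y h').1
  · rw [coords, hrep, huw, Finsupp.single_eq_same, add_zero]
  · rw [coords, hrep, Finsupp.single_eq_of_ne h, zero_add]; exact (hpos w y).coeff_zero
  · rw [← sub_eq_zero]
    refine eq_zero_of_bar_eq hbar ?_ fun y => ?_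
    · have h := hu w
      rw [sub_eq_sub_iff_add_eq_add] at h
      rw [map_sub, map_add, hC.bar_eq, ← h, add_comm (u w)]
    · rw [map_sub, Finsupp.sub_apply, hrep]
      by_cases h : y = w
      · rw [h, huw, Finsupp.single_eq_same, show b.repr (C w) w = 1 from hC.coeff.diagonal w,
          add_zero, sub_self]
        exact isPos_zero
      · rw [Finsupp.single_eq_of_ne h, zero_add]
        exact (hC.coeff.isPos h).sub (hpos w y)

end KLFamily

/-! ### The Hecke algebra -/

section HeckeAlgebra

variable {B : Type*} {M : CoxeterMatrix B} {R : Subring ℂ} {Γ : Type*} [AddCommGroup Γ] {L : B → Γ}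

namespace Hecke

/-- The generators `T_s` generate the Hecke algebra. -/
lemma induction_on {p : Hecke M R L → Prop} (coeff : ∀ a, p (algebraMap (Coeff R Γ) _ a))
    (gen : ∀ i, p (T M R L i)) (mul : ∀ x y, p x → p y → p (x * y))
    (add : ∀ x y, p x → p y → p (x + y)) (h : Hecke M R L) : p h := by
  obtain ⟨x, rfl⟩ := RingQuot.mkAlgHom_surjective (Coeff R Γ) (HeckeRel M R L) h
  induction x using FreeAlgebra.induction with
  | grade0 a =>
    rw [show RingQuot.mkAlgHom (Coeff R Γ) (HeckeRel M R L) (algebraMap _ _ a) = _ from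
      (RingQuot.mkAlgHom (Coeff R Γ) (HeckeRel M R L)).commutes a]
    exact coeff a
  | grade1 i => exact gen i
  | mul x y hx hy => rw [map_mul]; exact mul _ _ hx hy
  | add x y hx hy => rw [map_add]; exact add _ _ hx hy

lemma Phi_T_eq (i : B) : Phi M R L (T M R L i) = -Tinv M R L i := by rw [Phi_T, bar_T]

lemma Phi_Tinv (i : B) : Phi M R L (Tinv M R L i) = -T M R L i := by
  rw [Tinv, map_add, Phi_T_eq, AlgHom.commutes, Tinv, neg_add, add_assoc, ← map_neg, ← map_add]
  simp

lemma bar_Tinv (i : B) : bar M R L (Tinv M R L i) = T M R L i := by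
  rw [Tinv, map_add, bar_T, bar_algebraMap, Tinv, add_assoc, ← map_add]
  simp [barA_qpow]

lemma Phi_bar (h : Hecke M R L) : Phi M R L (bar M R L h) = bar M R L (Phi M R L h) := by
  induction h using induction_on with
  | coeff a => rw [bar_algebraMap, AlgHom.commutes, AlgHom.commutes, bar_algebraMap]
  | gen i => rw [bar_T, Phi_Tinv, Phi_T_eq, map_neg, bar_Tinv]
  | mul x y hx hy => simp only [map_mul, hx, hy]
  | add x y hx hy => simp only [map_add, hx, hy]

end Hecke

variable {N N' : Type*} [AddCommGroup N] [Module (Hecke M R L) N] [AddCommGroup N']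
  [Module (Hecke M R L) N']

lemma map_T_smul (f : N →ₛₗ[(Hecke.Phi M R L : Hecke M R L →+* Hecke M R L)] N') (i : B) (x : N) :
    f (Hecke.T M R L i • x) = -(Hecke.Tinv M R L i • f x) := by
  rw [map_smulₛₗ, RingHom.coe_coe, Hecke.Phi_T_eq, neg_smul]

lemma map_Tinv_smul (f : N →ₛₗ[(Hecke.Phi M R L : Hecke M R L →+* Hecke M R L)] N') (i : B)
    (x : N) : f (Hecke.Tinv M R L i • x) = -(Hecke.T M R L i • f x) := by
  rw [map_smulₛₗ, RingHom.coe_coe, Hecke.Phi_Tinv, neg_smul]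

end HeckeAlgebra

/-! ### Modules with a basis indexed by an ideal of the left weak order -/

section HeckeModule

variable {B W : Type*} [Group W] {M : CoxeterMatrix B} {cs : CoxeterSystem M W}
  {E : Set W} {J : Set B} {R : Subring ℂ} {Γ : Type*} [AddCommGroup Γ] {L : B → Γ}
  {N N' : Type*} [AddCommGroup N] [Module (Coeff R Γ) N] [Module (Hecke M R L) N]
  [AddCommGroup N'] [Module (Coeff R Γ) N']

/-- The four types of `s` with respect to `w` exhaust all cases. -/
lemma IsIdealWith.ascent_or_descent (hE : IsIdealWith cs E J) (i : B) (w : E) :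
    StrongDescent cs E i w ∨ StrongAscent cs E i w ∨ WeakDescent cs J i w ∨
      WeakAscent cs E J i w := by
  rcases cs.length_simple_mul w.1 i with h | h
  · have h' : cs.length w.1 < cs.length (cs.simple i * w.1) := by omega
    by_cases hE' : cs.simple i * w.1 ∈ E
    · exact Or.inr (Or.inl ⟨h', hE'⟩)
    · by_cases hD : cs.simple i * w.1 ∈ minReps cs J
      · exact Or.inr (Or.inr (Or.inr ⟨h', hD, hE'⟩))
      · exact Or.inr (Or.inr (Or.inl ⟨h', hD⟩))
  · refine Or.inl ⟨by omega, hE.suffix_mem w.1 w.2 _ ⟨cs.simple i, by simp, ?_⟩⟩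
    rw [cs.length_simple]; omega

/-- Every `w ≠ 1` in an ideal of the left weak order is a strong ascent `s w'` of some `w'` in the
ideal. -/
lemma IsIdealWith.induction_on (hE : IsIdealWith cs E J) {p : E → Prop} (one : p ⟨1, hE.one_mem⟩)
    (step : ∀ (i : B) (w : E) (h : StrongAscent cs E i w), p w → p ⟨cs.simple i * w, h.2⟩)
    (w : E) : p w := by
  obtain ⟨n, hn⟩ : ∃ n, cs.length w.1 = n := ⟨_, rfl⟩
  induction n generalizing w with
  | zero =>
    obtain ⟨w, hw⟩ := w
    obtain rfl : w = 1 := cs.length_eq_zero_iff.1 hn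
    exact one
  | succ n ih =>
    obtain ⟨w, hw⟩ := w
    have hw1 : w ≠ 1 := by rintro rfl; simp at hn
    obtain ⟨i, hi⟩ := cs.exists_leftDescent_of_ne_one hw1
    rw [cs.isLeftDescent_iff] at hi
    have hmem : cs.simple i * w ∈ E :=
      hE.suffix_mem w hw _ ⟨cs.simple i, by simp, by rw [cs.length_simple]; omega⟩
    have hasc : StrongAscent cs E i (cs.simple i * w) := by
      refine ⟨?_, ?_⟩
      · rw [cs.simple_mul_simple_cancel_left]; omega
      · rwa [cs.simple_mul_simple_cancel_left]
    have := step i ⟨_, hmem⟩ hasc (ih ⟨_, hmem⟩ (by simp only at hn ⊢; omega))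
    simpa using this

/-- `T_s Γ_w = Γ_{sw}` for the strong ascents `s` of `w`. -/
def HasStrongAscents (cs : CoxeterSystem M W) (L : B → Γ) {N : Type*} [AddCommGroup N]
    [Module (Coeff R Γ) N] [Module (Hecke M R L) N]
    (b : Module.Basis E (Coeff R Γ) N) : Prop :=
  ∀ (i : B) (w : E) (h : StrongAscent cs E i w),
    Hecke.T M R L i • b w = b ⟨cs.simple i * w, h.2⟩

/-- A linear map on a module generated by `Γ_1` is determined by the image of `Γ_1` and by its
commutation with the `T_s`. -/
lemma linearMap_ext_of_T (hE : IsIdealWith cs E J) {b : Module.Basis E (Coeff R Γ) N}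
    (hb : HasStrongAscents cs L b) {f g : N →ₗ[Coeff R Γ] N'} (u : B → N' → N')
    (hf : ∀ i x, f (Hecke.T M R L i • x) = u i (f x))
    (hg : ∀ i x, g (Hecke.T M R L i • x) = u i (g x))
    (h1 : f (b ⟨1, hE.one_mem⟩) = g (b ⟨1, hE.one_mem⟩)) : f = g := by
  refine b.ext fun w => ?_
  induction w using hE.induction_on with
  | one => exact h1
  | step i w h ih => rw [← hb i w h, hf, hg, ih]

variable [IsScalarTower (Coeff R Γ) (Hecke M R L) N]

/-- The bar involution is unitriangular if `T_s Γ_w` lies in the span of the `Γ_y` with `y ≤ w`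
for all `s` that are not strong ascents of `w`. -/
lemma isUnitriangular_bar (hE : IsIdealWith cs E J) {b : Module.Basis E (Coeff R Γ) N}
    (hb : HasStrongAscents cs L b)
    (hle : ∀ (i : B) (w : E), ¬ StrongAscent cs E i w → ∀ y,
      b.repr (Hecke.T M R L i • b w) y ≠ 0 → BruhatLE cs y.1 w.1)
    {bar : N →ₛₗ[barA R Γ] N} (hbar1 : bar (b ⟨1, hE.one_mem⟩) = b ⟨1, hE.one_mem⟩)
    (hbar : ∀ (h : Hecke M R L) (x : N), bar (h • x) = Hecke.bar M R L h • bar x) :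
    IsUnitriangular cs b bar := by
  suffices H : ∀ w : E, b.repr (bar (b w)) w = 1 ∧
      ∀ y, b.repr (bar (b w)) y ≠ 0 → BruhatLE cs y.1 w.1 from
    ⟨fun w => (H w).1, fun w => (H w).2⟩
  intro w
  induction w using hE.induction_on with
  | one =>
    rw [hbar1, b.repr_self]
    refine ⟨Finsupp.single_eq_same, fun y hy => ?_⟩
    by_cases h : y = ⟨1, hE.one_mem⟩
    · rw [h]; exact BruhatLE.refl cs _
    · exact absurd (Finsupp.single_eq_of_ne h) hy
  | step i w h ih =>
    obtain ⟨ih1, ih2⟩ := ih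
    set sw : E := ⟨cs.simple i * w, h.2⟩ with hsw
    set x := bar (b w) with hx
    have e : bar (b sw) = Hecke.T M R L i • x + (qpow R (-L i) - qpow R (L i)) • x := by
      rw [hsw, ← hb i w h, hbar, Hecke.bar_T, Hecke.Tinv, add_smul, algebraMap_smul]
    -- the action of `T_s` as an `A`-linear map
    let τ : N →ₗ[Coeff R Γ] N := Algebra.lsmul (Coeff R Γ) (Coeff R Γ) N (Hecke.T M R L i)
    have hτ : ∀ z, τ z = Hecke.T M R L i • z := fun z => rfl
    have hexp : ∀ y, b.repr (bar (b sw)) y =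
        ((b.repr x).sum fun z a => a * b.repr (Hecke.T M R L i • b z) y) +
          (qpow R (-L i) - qpow R (L i)) * b.repr x y := by
      intro y
      rw [e, map_add, Finsupp.add_apply, ← hτ, repr_semilinear_apply, map_smul, Finsupp.smul_apply,
        smul_eq_mul]
      rfl
    have hlt : cs.length w.1 < cs.length sw.1 := h.1
    have hterm : ∀ z y, b.repr x z ≠ 0 → b.repr (Hecke.T M R L i • b z) y ≠ 0 →
        BruhatLE cs y.1 sw.1 ∧ (y = sw → z = w) := by
      intro z y hz hy
      have hzw := ih2 z hz
      by_cases hasc : StrongAscent cs E i z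
      · rw [hb i z hasc, b.repr_self] at hy
        have hyz : y = ⟨cs.simple i * z, hasc.2⟩ :=
          by_contra fun h' => hy (Finsupp.single_eq_of_ne h')
        subst hyz
        refine ⟨hzw.simple_mul_le h.1, fun h' => Subtype.ext ?_⟩
        exact mul_left_cancel (congrArg Subtype.val h')
      · have hyw := (hle i z hasc y hy).trans hzw
        refine ⟨hyw.trans (bruhatLE_simple_mul h.1), fun h' => ?_⟩
        subst h'
        exact absurd hyw.length_le hlt.not_ge
    have hxsw : b.repr x sw = 0 := by
      by_contra h'
      exact absurd (ih2 sw h').length_le hlt.not_ge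
    constructor
    · rw [hexp, hxsw, mul_zero, add_zero, Finsupp.sum_eq_single w]
      · rw [ih1, one_mul, hb i w h, b.repr_self, Finsupp.single_eq_same]
      · intro z hz hzw
        by_contra h'
        exact hzw ((hterm z sw hz (right_ne_zero_of_mul h')).2 rfl)
      · intro _; rw [zero_mul]
    · intro y hy
      by_cases hxy : b.repr x y = 0
      · rw [hexp, hxy, mul_zero, add_zero] at hy
        obtain ⟨z, hz, hz'⟩ := Finset.exists_ne_zero_of_sum_ne_zero hy
        exact (hterm z y (Finsupp.mem_support_iff.1 hz) (right_ne_zero_of_mul hz')).1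
      · exact (ih2 y hxy).trans (bruhatLE_simple_mul h.1)

variable [Module (Hecke M R L) N']
  [IsScalarTower (Coeff R Γ) (Hecke M R L) N']

/-- A map that is semilinear over an endomorphism `φ` of the `A`-algebra `H`, as a linear map
over `A`. -/
def restrictCoeff (φ : Hecke M R L →ₐ[Coeff R Γ] Hecke M R L)
    (f : N →ₛₗ[(φ : Hecke M R L →+* Hecke M R L)] N') : N →ₗ[Coeff R Γ] N' where
  toFun := f
  map_add' := map_add f
  map_smul' a x := by
    have h := map_smulₛₗ f (algebraMap (Coeff R Γ) (Hecke M R L) a) x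
    rw [algebraMap_smul] at h
    rw [h, RingHom.id_apply, RingHom.coe_coe, AlgHom.commutes, algebraMap_smul]

lemma restrictCoeff_apply (φ : Hecke M R L →ₐ[Coeff R Γ] Hecke M R L)
    (f : N →ₛₗ[(φ : Hecke M R L →+* Hecke M R L)] N') (x : N) : restrictCoeff φ f x = f x := rfl

/-- An `A`-linear map that transforms the action of `T_s` into that of `Φ(T_s) = -T_s⁻¹`
is `Φ`-linear. -/
def phiLinearMap (f : N →ₗ[Coeff R Γ] N')
    (hf : ∀ i x, f (Hecke.T M R L i • x) = -(Hecke.Tinv M R L i • f x)) :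
    N →ₛₗ[(Hecke.Phi M R L : Hecke M R L →+* Hecke M R L)] N' where
  toFun := f
  map_add' := map_add f
  map_smul' h x := by
    rw [RingHom.coe_coe]
    induction h using Hecke.induction_on generalizing x with
    | coeff a => rw [AlgHom.commutes, algebraMap_smul, algebraMap_smul, map_smul]
    | gen i => rw [hf, Hecke.Phi_T_eq, neg_smul]
    | mul h h' ih ih' => rw [map_mul, mul_smul, mul_smul, ih, ih']
    | add h h' ih ih' => rw [map_add, add_smul, add_smul, map_add, ih, ih']

/-- `Φ`-linear maps that agree on the generator `Γ_1` are equal. -/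
lemma phiLinearMap_ext (hE : IsIdealWith cs E J) {b : Module.Basis E (Coeff R Γ) N}
    (hb : HasStrongAscents cs L b)
    {f g : N →ₛₗ[(Hecke.Phi M R L : Hecke M R L →+* Hecke M R L)] N'}
    (h1 : f (b ⟨1, hE.one_mem⟩) = g (b ⟨1, hE.one_mem⟩)) : f = g := by
  have h := linearMap_ext_of_T (f := restrictCoeff _ f) (g := restrictCoeff _ g) hE hb
    (fun i y => -(Hecke.Tinv M R L i • y)) (map_T_smul f) (map_T_smul g) h1
  exact LinearMap.ext fun x => LinearMap.congr_fun h x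

/-- `Φ`-linear maps in opposite directions that exchange the generators are mutually inverse. -/
lemma phiLinearMap_leftInverse (hE : IsIdealWith cs E J) {b : Module.Basis E (Coeff R Γ) N}
    (hb : HasStrongAscents cs L b) {y : N'}
    (f : N →ₛₗ[(Hecke.Phi M R L : Hecke M R L →+* Hecke M R L)] N')
    (g : N' →ₛₗ[(Hecke.Phi M R L : Hecke M R L →+* Hecke M R L)] N)
    (hf : f (b ⟨1, hE.one_mem⟩) = y) (hg : g y = b ⟨1, hE.one_mem⟩) : Function.LeftInverse g f := by
  have h := linearMap_ext_of_T (f := restrictCoeff _ g ∘ₗ restrictCoeff _ f)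
    (g := LinearMap.id) hE hb (fun i y => Hecke.T M R L i • y)
    (fun i x => by
      simp only [LinearMap.comp_apply, restrictCoeff_apply]
      rw [map_T_smul, map_neg, map_Tinv_smul, neg_neg])
    (fun i x => rfl) (by simp [restrictCoeff_apply, hf, hg])
  exact fun x => LinearMap.congr_fun h x

end HeckeModule

/-! ### The sign twist of a basis -/

section SignTwist

variable {B W : Type*} [Group W] {M : CoxeterMatrix B} (cs : CoxeterSystem M W)
  {E : Set W} {J : Set B} {R : Subring ℂ} {Γ : Type*} [AddCommGroup Γ]

lemma sgn_mul_self (w : W) : sgn cs R Γ w * sgn cs R Γ w = 1 := by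
  rw [sgn, ← mul_pow, show (-1 : Coeff R Γ) * -1 = 1 by ring, one_pow]

lemma barA_sgn (w : W) : barA R Γ (sgn cs R Γ w) = sgn cs R Γ w := by simp [sgn]

lemma sgn_one : sgn cs R Γ 1 = 1 := by simp [sgn]

lemma sgn_simple_mul (i : B) (w : W) : sgn cs R Γ (cs.simple i * w) = -sgn cs R Γ w := by
  rcases cs.length_simple_mul w i with h | h
  · rw [sgn, sgn, h, pow_succ]; ring
  · rw [sgn, sgn, ← h, pow_succ]; ring

variable {N N' : Type*} [AddCommGroup N] [Module (Coeff R Γ) N]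
  [AddCommGroup N'] [Module (Coeff R Γ) N']

/-- The semilinear map with `b w ↦ ε_w b' w`. -/
def signTwist (b : Module.Basis E (Coeff R Γ) N) (b' : Module.Basis E (Coeff R Γ) N') :
    N →ₛₗ[barA R Γ] N' where
  toFun x := (b.repr x).sum fun y a => (sgn cs R Γ y * barA R Γ a) • b' y
  map_add' x y := by
    rw [map_add]
    exact Finsupp.sum_add_index' (by simp) (by simp [mul_add, add_smul])
  map_smul' c x := by
    rw [map_smul, Finsupp.sum_smul_index' (by simp), Finsupp.smul_sum]
    refine Finsupp.sum_congr fun y _ => ?_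
    rw [smul_eq_mul, map_mul, smul_smul, mul_left_comm]

lemma signTwist_apply (b : Module.Basis E (Coeff R Γ) N) (b' : Module.Basis E (Coeff R Γ) N')
    (x : N) : signTwist cs b b' x =
      (b.repr x).sum fun y a => (sgn cs R Γ y * barA R Γ a) • b' y := rfl

lemma signTwist_basis (b : Module.Basis E (Coeff R Γ) N) (b' : Module.Basis E (Coeff R Γ) N')
    (w : E) : signTwist cs b b' (b w) = sgn cs R Γ w • b' w := by
  rw [signTwist_apply, b.repr_self, Finsupp.sum_single_index] <;> simp

lemma signTwist_signTwist (b : Module.Basis E (Coeff R Γ) N) (b' : Module.Basis E (Coeff R Γ) N')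
    (x : N) : signTwist cs b' b (signTwist cs b b' x) = x := by
  conv_lhs => rw [signTwist_apply cs b b', Finsupp.sum, map_sum]
  conv_rhs => rw [← b.linearCombination_repr x, Finsupp.linearCombination_apply, Finsupp.sum]
  refine Finset.sum_congr rfl fun y _ => ?_
  rw [map_smulₛₗ, signTwist_basis, map_mul, barA_barA, barA_sgn, smul_smul, mul_right_comm,
    sgn_mul_self, one_mul]

/-- The linear map with `b w ↦ ε_w \overline{b' w}`. -/
def barSignTwist (b : Module.Basis E (Coeff R Γ) N) (b' : Module.Basis E (Coeff R Γ) N')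
    (bar : N' →ₛₗ[barA R Γ] N') : N →ₗ[Coeff R Γ] N' where
  toFun x := bar (signTwist cs b b' x)
  map_add' x y := by rw [map_add, map_add]
  map_smul' c x := by rw [map_smulₛₗ, map_smulₛₗ, barA_barA, RingHom.id_apply]

lemma barSignTwist_apply (b : Module.Basis E (Coeff R Γ) N) (b' : Module.Basis E (Coeff R Γ) N')
    (bar : N' →ₛₗ[barA R Γ] N') (x : N) :
    barSignTwist cs b b' bar x = bar (signTwist cs b b' x) := rfl

end SignTwist

/-! ### Twisting a module by `Φ` -/

section PhiTwist

variable {B : Type*} {M : CoxeterMatrix B} {R : Subring ℂ} {Γ : Type*} [AddCommGroup Γ] {L : B → Γ}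

/-- The module `N`, with the action of the Hecke algebra composed with `Φ`. -/
def PhiTwist (N : Type*) : Type _ := N

variable (N : Type*) [AddCommGroup N] [Module (Coeff R Γ) N] [Module (Hecke M R L) N]

instance : AddCommGroup (PhiTwist N) := inferInstanceAs (AddCommGroup N)

instance : Module (Coeff R Γ) (PhiTwist N) := inferInstanceAs (Module (Coeff R Γ) N)

instance : Module (Hecke M R L) (PhiTwist N) :=
  Module.compHom N (Hecke.Phi M R L : Hecke M R L →+* Hecke M R L)

lemma smul_comm_hecke {N : Type*} [AddCommGroup N] [Module (Coeff R Γ) N]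
    [Module (Hecke M R L) N] [IsScalarTower (Coeff R Γ) (Hecke M R L) N] (h : Hecke M R L)
    (a : Coeff R Γ) (x : N) : h • a • x = a • h • x := by
  rw [← algebraMap_smul (Hecke M R L) a x, smul_smul, ← Algebra.commutes, mul_smul, algebraMap_smul]

/-- The identity map of `N`, as a map to `PhiTwist N`. -/
def toPhiTwist (R : Subring ℂ) (Γ : Type*) [AddCommGroup Γ] (N : Type*) [AddCommGroup N]
    [Module (Coeff R Γ) N] : N ≃ₗ[Coeff R Γ] PhiTwist N := LinearEquiv.refl _ _

variable {N}

lemma smul_toPhiTwist (h : Hecke M R L) (x : N) :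
    h • toPhiTwist R Γ N x = toPhiTwist R Γ N (Hecke.Phi M R L h • x) := rfl

instance [IsScalarTower (Coeff R Γ) (Hecke M R L) N] :
    IsScalarTower (Coeff R Γ) (Hecke M R L) (PhiTwist N) where
  smul_assoc a h x := by
    obtain ⟨x, rfl⟩ := (toPhiTwist R Γ N).surjective x
    rw [smul_toPhiTwist, smul_toPhiTwist, map_smul (Hecke.Phi M R L), smul_assoc,
      (toPhiTwist R Γ N).map_smul]

end PhiTwist

/-! ### The dual module -/

section Dual

variable {B W : Type*} [Group W] {M : CoxeterMatrix B} {cs : CoxeterSystem M W}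
  {E : Set W} {J : Set B} {R : Subring ℂ} {Γ : Type*} [AddCommGroup Γ] [LinearOrder Γ] {L : B → Γ}
  {N : Type*} [AddCommGroup N] [Module (Coeff R Γ) N] [Module (Hecke M R L) N]
  [IsScalarTower (Coeff R Γ) (Hecke M R L) N] (D : IdealModule cs E J R L N)

/-- A dual module: `M` with the action twisted by `Φ`, and `\tilde Γ_w = ε_w \overline{Γ_w}`. -/
def dualModule : DualModule D (PhiTwist N) :=
  have hκ : Function.Bijective (barSignTwist cs D.basis D.basis D.bar) :=
    (Function.Involutive.bijective D.bar_bar).comp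
      (Function.Involutive.bijective (signTwist_signTwist cs D.basis D.basis))
  let ι := toPhiTwist R Γ N
  let b := D.basis.map ((LinearEquiv.ofBijective _ hκ).trans ι)
  have hb : ∀ w, b w = ι (sgn cs R Γ w • D.bar (D.basis w)) := fun w => by
    simp only [b, Module.Basis.map_apply, LinearEquiv.trans_apply, LinearEquiv.ofBijective_apply]
    rw [barSignTwist_apply, signTwist_basis, map_smulₛₗ, barA_sgn]
  have hT : ∀ i w, Hecke.T M R L i • b w =
      ι (-(sgn cs R Γ w • D.bar (Hecke.T M R L i • D.basis w))) := fun i w => by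
    rw [hb, smul_toPhiTwist, Hecke.Phi_T, neg_smul, smul_comm_hecke, D.bar_smul]
  { basis := b
    T_strongDescent := fun i w h => by
      rw [hT, D.T_strongDescent i w h, hb, hb, ← ι.map_smul, ← ι.map_add, sgn_simple_mul,
        map_add, map_smulₛₗ, map_sub, barA_qpow, barA_qpow, neg_neg]
      congr 1
      module
    T_strongAscent := fun i w h => by
      rw [hT, D.T_strongAscent i w h, hb, sgn_simple_mul, neg_smul]
    T_weakDescent := fun i w h => by
      rw [hT, D.T_weakDescent i w h, hb, ← ι.map_smul, map_neg D.bar, map_smulₛₗ D.bar, barA_qpow,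
        neg_neg]
      congr 1
      module
    T_weakAscent := fun i w h => by
      have hsum : ((D.r i w).sum fun z a => (sgn cs R Γ z * sgn cs R Γ w * barA R Γ a) • b z) =
          ι (sgn cs R Γ w • D.bar ((D.r i w).sum fun z a => a • D.basis z)) := by
        rw [Finsupp.sum, Finsupp.sum, map_sum, Finset.smul_sum, map_sum]
        refine Finset.sum_congr rfl fun z _ => ?_
        rw [hb, ← ι.map_smul, map_smulₛₗ D.bar, smul_smul, smul_smul]
        congr 2
        linear_combination (barA R Γ (D.r i w z) * sgn cs R Γ w) *
          sgn_mul_self cs (R := R) (Γ := Γ) z.1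
      rw [hsum, hT, D.T_weakAscent i w h, hb, ← ι.map_smul, ← map_neg ι, ← ι.map_add,
        map_sub D.bar, map_smulₛₗ D.bar, barA_qpow]
      congr 1
      module
    bar := (ι.toLinearMap.comp D.bar).comp ι.symm.toLinearMap
    bar_bar := fun x => D.bar_bar x
    bar_basis_one := by
      rw [hb, sgn_one, one_smul, D.bar_basis_one]
      exact D.bar_basis_one
    bar_smul := fun h x => by
      obtain ⟨y, rfl⟩ := ι.surjective x
      change ι (D.bar (Hecke.Phi M R L h • y)) = Hecke.bar M R L h • ι (D.bar y)
      rw [D.bar_smul, smul_toPhiTwist, Hecke.Phi_bar] }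

lemma IdealModule.hasStrongAscents : HasStrongAscents cs L D.basis := D.T_strongAscent

lemma repr_sum_ne_zero {ι A N : Type*} [CommRing A] [AddCommGroup N] [Module A N]
    {b : Module.Basis ι A N} (f : ι →₀ A) (g : ι → A → A) (y : ι)
    (h : b.repr (f.sum fun z a => g z a • b z) y ≠ 0) : f y ≠ 0 := by
  classical
  intro h0
  apply h
  rw [Finsupp.sum, map_sum, Finsupp.finsetSum_apply]
  refine Finset.sum_eq_zero fun z hz => ?_
  have hzy : y ≠ z := by rintro rfl; exact Finsupp.mem_support_iff.1 hz h0
  rw [map_smul, Finsupp.smul_apply, b.repr_self, Finsupp.single_eq_of_ne hzy, smul_zero]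

lemma repr_basis_ne_zero {ι A N : Type*} [CommRing A] [AddCommGroup N] [Module A N]
    {b : Module.Basis ι A N} {w y : ι} (h : b.repr (b w) y ≠ 0) : y = w := by
  rw [b.repr_self] at h
  exact by_contra fun h' => h (Finsupp.single_eq_of_ne h')

lemma IdealModule.isUnitriangular : IsUnitriangular cs D.basis D.bar := by
  refine isUnitriangular_bar D.isIdeal D.hasStrongAscents (fun i w hw y hy => ?_)
    D.bar_basis_one D.bar_smul
  by_cases hyw : y = w
  · rw [hyw]; exact BruhatLE.refl cs _
  have hyw' : D.basis.repr (D.basis w) y = 0 := by_contra fun h => hyw (repr_basis_ne_zero h)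
  rcases D.isIdeal.ascent_or_descent i w with h | h | h | h
  · rw [D.T_strongDescent i w h, map_add, map_smul, Finsupp.add_apply, Finsupp.smul_apply, hyw',
      smul_zero, add_zero] at hy
    rw [repr_basis_ne_zero hy]
    exact simple_mul_bruhatLE h.1
  · exact absurd h hw
  · exact absurd (by rw [D.T_weakDescent i w h, map_neg, map_smul, Finsupp.neg_apply,
      Finsupp.smul_apply, hyw', smul_zero, neg_zero]) hy
  · rw [D.T_weakAscent i w h, map_sub, map_smul, Finsupp.sub_apply, Finsupp.smul_apply, hyw',
      smul_zero, zero_sub, neg_ne_zero] at hy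
    exact (D.r_lt i w h y (repr_sum_ne_zero _ _ y hy)).1

variable {D}
variable {N' : Type*} [AddCommGroup N'] [Module (Coeff R Γ) N'] [Module (Hecke M R L) N']
  [IsScalarTower (Coeff R Γ) (Hecke M R L) N'] (D' : DualModule D N')

lemma DualModule.hasStrongAscents : HasStrongAscents cs L D'.basis := D'.T_strongAscent

lemma DualModule.isUnitriangular : IsUnitriangular cs D'.basis D'.bar := by
  refine isUnitriangular_bar D.isIdeal D'.hasStrongAscents (fun i w hw y hy => ?_)
    D'.bar_basis_one D'.bar_smul
  by_cases hyw : y = w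
  · rw [hyw]; exact BruhatLE.refl cs _
  have hyw' : D'.basis.repr (D'.basis w) y = 0 := by_contra fun h => hyw (repr_basis_ne_zero h)
  rcases D.isIdeal.ascent_or_descent i w with h | h | h | h
  · rw [D'.T_strongDescent i w h, map_add, map_smul, Finsupp.add_apply, Finsupp.smul_apply, hyw',
      smul_zero, add_zero] at hy
    rw [repr_basis_ne_zero hy]
    exact simple_mul_bruhatLE h.1
  · exact absurd h hw
  · exact absurd (by rw [D'.T_weakDescent i w h, map_smul,
      Finsupp.smul_apply, hyw', smul_zero]) hy
  · rw [D'.T_weakAscent i w h, map_add, map_neg, map_smul, Finsupp.add_apply, Finsupp.neg_apply,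
      Finsupp.smul_apply, hyw', smul_zero, neg_zero, zero_add] at hy
    exact (D.r_lt i w h y (repr_sum_ne_zero _ _ y hy)).1

/-- The formulas for the action on `M` and on its dual module say that the semilinear map with
`Γ_w ↦ ε_w \tilde Γ_w` anticommutes with the `T_s`. -/
lemma DualModule.signTwist_T_smul (i : B) (x : N) :
    signTwist cs D.basis D'.basis (Hecke.T M R L i • x) =
      -(Hecke.T M R L i • signTwist cs D.basis D'.basis x) := by
  let τ : N →ₗ[Coeff R Γ] N := Algebra.lsmul (Coeff R Γ) (Coeff R Γ) N (Hecke.T M R L i)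
  let τ' : N' →ₗ[Coeff R Γ] N' := Algebra.lsmul (Coeff R Γ) (Coeff R Γ) N' (Hecke.T M R L i)
  suffices H : (signTwist cs D.basis D'.basis).comp τ =
      (-τ').comp (signTwist cs D.basis D'.basis) from LinearMap.congr_fun H x
  refine D.basis.ext fun w => ?_
  change signTwist cs D.basis D'.basis (Hecke.T M R L i • D.basis w) =
      -(Hecke.T M R L i • signTwist cs D.basis D'.basis (D.basis w))
  rw [signTwist_basis, smul_comm_hecke]
  rcases D.isIdeal.ascent_or_descent i w with h | h | h | h
  · rw [D.T_strongDescent i w h, D'.T_strongDescent i w h, map_add, map_smulₛₗ, signTwist_basis,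
      signTwist_basis, sgn_simple_mul, map_sub, barA_qpow, barA_qpow, neg_neg]
    module
  · rw [D.T_strongAscent i w h, D'.T_strongAscent i w h, signTwist_basis, sgn_simple_mul, neg_smul]
  · rw [D.T_weakDescent i w h, D'.T_weakDescent i w h, map_neg, map_smulₛₗ, signTwist_basis,
      barA_qpow, neg_neg, smul_comm]
  · have hsum : signTwist cs D.basis D'.basis ((D.r i w).sum fun z a => a • D.basis z) =
        sgn cs R Γ w • (D.r i w).sum fun z a =>
          (sgn cs R Γ z * sgn cs R Γ w * barA R Γ a) • D'.basis z := by
      rw [Finsupp.sum, Finsupp.sum, map_sum, Finset.smul_sum]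
      refine Finset.sum_congr rfl fun z _ => ?_
      rw [map_smulₛₗ, signTwist_basis, smul_smul, smul_smul]
      congr 1
      linear_combination (-barA R Γ (D.r i w z) * sgn cs R Γ z) *
        sgn_mul_self cs (R := R) (Γ := Γ) w.1
    rw [D.T_weakAscent i w h, D'.T_weakAscent i w h, map_sub, map_smulₛₗ, signTwist_basis,
      barA_qpow, hsum]
    module

lemma DualModule.signTwist_symm_T_smul (i : B) (x : N') :
    signTwist cs D'.basis D.basis (Hecke.T M R L i • x) =
      -(Hecke.T M R L i • signTwist cs D'.basis D.basis x) := by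
  have h := D'.signTwist_T_smul i (signTwist cs D'.basis D.basis x)
  rw [signTwist_signTwist] at h
  rw [← neg_eq_iff_eq_neg.2 h, map_neg, signTwist_signTwist]

end Dual

/-! ### Dual Kazhdan–Lusztig families -/

section DualKLFamily

variable {B W : Type*} [Group W] {M : CoxeterMatrix B} {cs : CoxeterSystem M W}
  {E : Set W} {R : Subring ℂ} {Γ : Type*} [AddCommGroup Γ]
  {N N' : Type*} [AddCommGroup N] [Module (Coeff R Γ) N] [AddCommGroup N'] [Module (Coeff R Γ) N']
  {b : Module.Basis E (Coeff R Γ) N} {b' : Module.Basis E (Coeff R Γ) N'}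
  {bar : N →ₛₗ[barA R Γ] N} {bar' : N' →ₛₗ[barA R Γ] N'}

/-- The commutation needed in `IsKLFamily.dual`, for `θ` with inverse
`b w ↦ ε_w \overline{b' w}`. -/
lemma signTwist_bar_comm (hbb : ∀ x, bar (bar x) = x)
    (hinv : ∀ x, bar (signTwist cs b' b (bar' (signTwist cs b b' x))) = x) (x : N') :
    signTwist cs b' b (bar' x) = bar (signTwist cs b' b x) := by
  have h := hinv (signTwist cs b' b x)
  rw [signTwist_signTwist] at h
  rw [← h, hbb]

variable [LinearOrder Γ] [IsOrderedAddMonoid Γ]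

/-- If the semilinear map `b' w ↦ ε_w b w` commutes with the bar involutions, then it sends the
Kazhdan–Lusztig family of `b'` to the unique dual Kazhdan–Lusztig family of `b`. So does
the linear map `θ`, its composition with the bar involution, since the two agree on bar-invariant
elements. -/
lemma IsKLFamily.dual (hbar' : IsUnitriangular cs b' bar') (hbb : ∀ x, bar (bar x) = x)
    (hbb' : ∀ x, bar' (bar' x) = x)
    (hcomm : ∀ x, signTwist cs b' b (bar' x) = bar (signTwist cs b' b x))
    {θ : N' → N} (hθ : ∀ x, θ x = bar (signTwist cs b' b x))
    {C' : E → N'} (hC' : IsKLFamily cs b' bar' C') :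
    (∃ b₁ : Module.Basis E (Coeff R Γ) N, ∀ w, b₁ w = θ (C' w)) ∧
      IsDualKLFamily cs b bar (fun w => θ (C' w)) (coords b' C') ∧
      ∀ (c : E → N) (p : E → E →₀ Coeff R Γ), IsDualKLFamily cs b bar c p →
        (∀ w, c w = θ (C' w)) ∧ p = coords b' C' := by
  have hθC : ∀ w, θ (C' w) = signTwist cs b' b (C' w) := fun w => by
    rw [hθ, ← hcomm, hC'.bar_eq]
  refine ⟨?_, ⟨fun w => ?_, fun w => ?_, hC'.coeff⟩, fun c p hc => ?_⟩
  · obtain ⟨b₀, hb₀⟩ := hC'.coeff.exists_basis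
    have hbij : Function.Bijective (barSignTwist cs b' b bar) :=
      (Function.Involutive.bijective hbb).comp
        (Function.bijective_iff_has_inverse.2 ⟨signTwist cs b b', signTwist_signTwist cs b' b,
          signTwist_signTwist cs b b'⟩)
    refine ⟨b₀.map (LinearEquiv.ofBijective _ hbij), fun w => ?_⟩
    rw [Module.Basis.map_apply, LinearEquiv.ofBijective_apply, barSignTwist_apply, hb₀, hθ]
  · rw [hθC, ← hcomm, hC'.bar_eq]
  · rw [hθC]; rfl
  · have hcx : ∀ w, c w = signTwist cs b' b (b'.repr.symm (p w)) := fun w => by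
      rw [hc.expansion w, signTwist_apply, LinearEquiv.apply_symm_apply]
    have hp : coords b' (fun w => b'.repr.symm (p w)) = p :=
      funext fun w => LinearEquiv.apply_symm_apply _ _
    have hx : IsKLFamily cs b' bar' fun w => b'.repr.symm (p w) := by
      refine ⟨fun w => ?_, by rw [hp]; exact hc.coeff⟩
      have h := hc.bar_eq w
      rw [hcx, ← hcomm] at h
      exact (Function.LeftInverse.injective (signTwist_signTwist cs b' b)) h
    have h := (existsUnique_isKLFamily hbar' hbb').unique hx hC'
    refine ⟨fun w => ?_, by rw [← h, hp]⟩
    rw [hcx, hθC, ← h]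

end DualKLFamily

/-! ### The maps `η` and `θ` -/

section DualMaps

variable {B W : Type*} [Group W] {M : CoxeterMatrix B} {cs : CoxeterSystem M W}
  {E : Set W} {J : Set B} {R : Subring ℂ} {Γ : Type*} [AddCommGroup Γ] [LinearOrder Γ] {L : B → Γ}
  {N : Type*} [AddCommGroup N] [Module (Coeff R Γ) N] [Module (Hecke M R L) N]
  [IsScalarTower (Coeff R Γ) (Hecke M R L) N] {D : IdealModule cs E J R L N}
  {N' : Type*} [AddCommGroup N'] [Module (Coeff R Γ) N'] [Module (Hecke M R L) N']
  [IsScalarTower (Coeff R Γ) (Hecke M R L) N'] (D' : DualModule D N')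

/-- The map `η : M → \tilde M` with `Γ_w ↦ ε_w \overline{\tilde Γ_w}`. -/
def DualModule.eta : N →ₛₗ[(Hecke.Phi M R L : Hecke M R L →+* Hecke M R L)] N' :=
  phiLinearMap (barSignTwist cs D.basis D'.basis D'.bar) fun i x => by
    rw [barSignTwist_apply, D'.signTwist_T_smul, map_neg, D'.bar_smul, Hecke.bar_T]; rfl

/-- The map `θ : \tilde M → M` with `\tilde Γ_w ↦ ε_w \overline{Γ_w}`. -/
def DualModule.theta : N' →ₛₗ[(Hecke.Phi M R L : Hecke M R L →+* Hecke M R L)] N :=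
  phiLinearMap (barSignTwist cs D'.basis D.basis D.bar) fun i x => by
    rw [barSignTwist_apply, D'.signTwist_symm_T_smul, map_neg, D.bar_smul, Hecke.bar_T]; rfl

lemma DualModule.eta_apply (x : N) :
    D'.eta x = D'.bar (signTwist cs D.basis D'.basis x) := rfl

lemma DualModule.theta_apply (x : N') :
    D'.theta x = D.bar (signTwist cs D'.basis D.basis x) := rfl

lemma DualModule.eta_basis_one :
    D'.eta (D.basis ⟨1, D.isIdeal.one_mem⟩) = D'.basis ⟨1, D.isIdeal.one_mem⟩ := by
  rw [eta_apply, signTwist_basis, sgn_one, one_smul, D'.bar_basis_one]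

lemma DualModule.theta_basis_one :
    D'.theta (D'.basis ⟨1, D.isIdeal.one_mem⟩) = D.basis ⟨1, D.isIdeal.one_mem⟩ := by
  rw [theta_apply, signTwist_basis, sgn_one, one_smul, D.bar_basis_one]

end DualMaps

end WGraph

end

theorem proposition3p6 {B W : Type*} [Group W] {M : CoxeterMatrix B} (cs : CoxeterSystem M W)
    {Γ : Type*} [AddCommGroup Γ] [LinearOrder Γ] [IsOrderedAddMonoid Γ]
    (L : B → Γ) (hL : IsWeight cs L) (R : Subring ℂ) (E : Set W) (J : Set B)
    {N : Type u} [AddCommGroup N] [Module (Coeff R Γ) N] [Module (Hecke M R L) N]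
    [IsScalarTower (Coeff R Γ) (Hecke M R L) N] (D : IdealModule cs E J R L N) :
    -- a dual module exists
    (∃ (N' : Type u) (_ : AddCommGroup N') (_ : Module (Coeff R Γ) N')
        (_ : Module (Hecke M R L) N') (_ : IsScalarTower (Coeff R Γ) (Hecke M R L) N'),
        Nonempty (DualModule D N')) ∧
    -- and for every dual module the following holds
    ∀ {N' : Type v} [AddCommGroup N'] [Module (Coeff R Γ) N'] [Module (Hecke M R L) N']
      [IsScalarTower (Coeff R Γ) (Hecke M R L) N'] (D' : DualModule D N'),
      -- the maps `η`, `θ` and the families `C`, `C̃` exist and are unique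
      (∃! η : N →ₛₗ[(Hecke.Phi M R L : Hecke M R L →+* Hecke M R L)] N',
        η (D.basis ⟨1, D.isIdeal.one_mem⟩) = D'.basis ⟨1, D.isIdeal.one_mem⟩) ∧
      (∃! θ : N' →ₛₗ[(Hecke.Phi M R L : Hecke M R L →+* Hecke M R L)] N,
        θ (D'.basis ⟨1, D.isIdeal.one_mem⟩) = D.basis ⟨1, D.isIdeal.one_mem⟩) ∧
      (∃! C : E → N, IsKLFamily cs D.basis D.bar C) ∧
      (∃! C' : E → N', IsKLFamily cs D'.basis D'.bar C') ∧
      ∀ (η : N →ₛₗ[(Hecke.Phi M R L : Hecke M R L →+* Hecke M R L)] N')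
        (θ : N' →ₛₗ[(Hecke.Phi M R L : Hecke M R L →+* Hecke M R L)] N)
        (C : E → N) (C' : E → N'),
        η (D.basis ⟨1, D.isIdeal.one_mem⟩) = D'.basis ⟨1, D.isIdeal.one_mem⟩ →
        θ (D'.basis ⟨1, D.isIdeal.one_mem⟩) = D.basis ⟨1, D.isIdeal.one_mem⟩ →
        IsKLFamily cs D.basis D.bar C →
        IsKLFamily cs D'.basis D'.bar C' →
        -- `θ` and `η` are inverse to each other
        (Function.LeftInverse θ η ∧ Function.RightInverse θ η) ∧
        -- (a) the basis `θ(C̃_w)` of `M(E_J, L)`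
        ((∃ b : Module.Basis E (Coeff R Γ) N, ∀ w, b w = θ (C' w)) ∧
          IsDualKLFamily cs D.basis D.bar (fun w => θ (C' w)) (coords D'.basis C') ∧
          Recursion cs (coords D'.basis fun y => D'.bar (D'.basis y)) (coords D'.basis C') ∧
          ∀ (c : E → N) (p : E → E →₀ Coeff R Γ), IsDualKLFamily cs D.basis D.bar c p →
            (∀ w, c w = θ (C' w)) ∧ p = coords D'.basis C') ∧
        -- (b) the basis `η(C_w)` of the dual module
        ((∃ b : Module.Basis E (Coeff R Γ) N', ∀ w, b w = η (C w)) ∧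
          IsDualKLFamily cs D'.basis D'.bar (fun w => η (C w)) (coords D.basis C) ∧
          Recursion cs (coords D.basis fun y => D.bar (D.basis y)) (coords D.basis C) ∧
          ∀ (c : E → N') (p : E → E →₀ Coeff R Γ), IsDualKLFamily cs D'.basis D'.bar c p →
            (∀ w, c w = η (C w)) ∧ p = coords D.basis C) := by
  refine ⟨⟨PhiTwist N, inferInstance, inferInstance, inferInstance, inferInstance,
    ⟨dualModule D⟩⟩, ?_⟩
  intro N' _ _ _ _ D'
  have hη : ∀ η : N →ₛₗ[(Hecke.Phi M R L : Hecke M R L →+* Hecke M R L)] N',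
      η (D.basis ⟨1, D.isIdeal.one_mem⟩) = D'.basis ⟨1, D.isIdeal.one_mem⟩ → η = D'.eta :=
    fun η h => phiLinearMap_ext D.isIdeal D.hasStrongAscents (h.trans D'.eta_basis_one.symm)
  have hθ : ∀ θ : N' →ₛₗ[(Hecke.Phi M R L : Hecke M R L →+* Hecke M R L)] N,
      θ (D'.basis ⟨1, D.isIdeal.one_mem⟩) = D.basis ⟨1, D.isIdeal.one_mem⟩ → θ = D'.theta :=
    fun θ h => phiLinearMap_ext D.isIdeal D'.hasStrongAscents (h.trans D'.theta_basis_one.symm)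
  have hinv : Function.LeftInverse D'.theta D'.eta :=
    phiLinearMap_leftInverse D.isIdeal D.hasStrongAscents _ _ D'.eta_basis_one D'.theta_basis_one
  have hinv' : Function.RightInverse D'.theta D'.eta :=
    phiLinearMap_leftInverse D.isIdeal D'.hasStrongAscents _ _ D'.theta_basis_one D'.eta_basis_one
  refine ⟨⟨D'.eta, D'.eta_basis_one, hη⟩, ⟨D'.theta, D'.theta_basis_one, hθ⟩,
    existsUnique_isKLFamily D.isUnitriangular D.bar_bar,
    existsUnique_isKLFamily D'.isUnitriangular D'.bar_bar, ?_⟩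
  intro η θ C C' h1 h1' hC hC'
  obtain rfl := hη η h1
  obtain rfl := hθ θ h1'
  obtain ⟨ha, ha', ha''⟩ := hC'.dual D'.isUnitriangular D.bar_bar D'.bar_bar
    (signTwist_bar_comm D.bar_bar hinv) D'.theta_apply
  obtain ⟨hb, hb', hb''⟩ := hC.dual D.isUnitriangular D'.bar_bar D.bar_bar
    (signTwist_bar_comm D'.bar_bar hinv') D'.eta_apply
  exact ⟨⟨hinv, hinv'⟩, ⟨ha, ha', hC'.recursion D'.isUnitriangular, ha''⟩,
    ⟨hb, hb', hC.recursion D.isUnitriangular, hb''⟩⟩
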